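/- Let $R$ be a Noetherian integrally closed domain with field of fractions $K$, let $m\ge 0$, let $A=R[x_0^{\pm1},\dots,x_m^{\pm1}]$, and let $K(\mathbf x)$ be the field of fractions of $A$. Let $H$ be an $A$-algebra that is free and finitely generated as an $A$-module, such that $K(\mathbf x)H:=K(\mathbf x)\otimes_A H$ is split semisimple, with a symmetrizing form $t:H\to A$ (an $A$-linear form with $t(hk)=t(kh)$ such that $h\mapsto(x\mapsto t(hx))$ is an isomorphism $H\to\mathrm{Hom}_A(H,A)$). For $\chi\in\mathrm{Irr}(K(\mathbf x)H)$ let $\chi^\vee\in K(\mathbf x)H$ be the element with $t(\chi^\vee h)=\chi(h)$ for all $h$, and let the Schur element $s_\chi$ be the scalar by which $\chi^\vee$ acts on the simple module with character $\chi$. Assume that $H$ is essential: every $s_\chi$ can be written as $$s_\chi=\xi_\chi N_\chi\prod_{i\in I_\chi}\Psi_{\chi,i}(M_{\chi,i})^{n_{\chi,i}}\qquad(*)$$ with $\xi_\chi\in R$, $N_\chi$ a monomial of total degree $0$, $I_\chi$ finite, $n_{\chi,i}\geq 1$, each $\Psi_{\chi,i}\in R[x]$ monic of degree at least $1$, irreducible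 over $K$, prime to $x$ and to $x-1$ in $K[x]$, with constant term a unit of $R$, and each $M_{\chi,i}=\prod_j x_j^{a_j}$ a monomial of total degree $0$ with $\gcd(a_j)=1$. Let $\mathfrak p$ be a prime ideal of $R$ and let $M=\prod_j x_j^{a_j}$ be a monomial with $\gcd(a_j)=1$. Say that $M$ is $\mathfrak p$-essential for $\chi$ if in some factorization $(*)$ of $s_\chi$ one has $M=M_{\chi,i}$ and $\Psi_{\chi,i}(1)\in\mathfrak p$ for some $i$. Put $\mathfrak q_M=(M-1)A+\mathfrak pA$; the ideals $\mathfrak pA$ and $\mathfrak q_M$ of $A$ are prime. For a prime ideal $\mathfrak q$ of $A$, a block of $A_{\mathfrak q}H:=A_{\mathfrak q}\otimes_A H$ is the set of all $\chi\in\mathrm{Irr}(K(\mathbf x)H)$ that belong to some primitive idempotent $e$ of the center of $A_{\mathfrak q}H$ (that is, $e$ acts as the identity on the simple module with character $\chi$); likewise for other base rings. 1. If $C$ is a block of $A_{\mathfrak pA}H$ and $M$ is not $\mathfrak p$-essential for any $\chi\in C$, then $C$ is a block of $A_{\mathfrak q_M}H$. 2. If $M$ is $\mathfrak p$-essential for no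 $\chi\in\mathrm{Irr}(K(\mathbf x)H)$, then the blocks of $A_{\mathfrak pA}H$ and of $A_{\mathfrak q_M}H$ coincide. 3. Let $B=R[y_1^{\pm1},\dots,y_m^{\pm1}]$ with field of fractions $K(\mathbf y)$, and let $\varphi_M:A\to B$ be a morphism associated with $M$, i.e. the $R$-algebra morphism induced on group algebras $R[\mathbb Z^{m+1}]\to R[\mathbb Z^m]$ by a surjective homomorphism $\mathbb Z^{m+1}\to\mathbb Z^m$ with kernel $\mathbb Z(a_0,\dots,a_m)$. Let $H_{\varphi_M}=B\otimes_A H$. Then $\chi(h)\in A$ for all $\chi\in\mathrm{Irr}(K(\mathbf x)H)$ and $h\in H$, and there is a bijection $\tau:\mathrm{Irr}(K(\mathbf x)H)\to\mathrm{Irr}(K(\mathbf y)H_{\varphi_M})$ with $\tau(\chi)(1\otimes h)=\varphi_M(\chi(h))$; and with this identification, every $C$ as in 1 is also a block of $B_{\mathfrak pB}H_{\varphi_M}$, and under the hypothesis of 2 the blocks of $A_{\mathfrak pA}H$ coincide with those of $B_{\mathfrak pB}H_{\varphi_M}$. -/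

import Mathlib

open scoped TensorProduct

noncomputable section

namespace EssentialAlgebra

universe u v w

/-! ### Laurent polynomial rings, monomials, and the ideals attached to them -/

/-- The Laurent polynomial ring over `R` in `n` indeterminates, as the group algebra `R[ℤⁿ]`. -/
abbrev Laurent (R : Type u) [CommRing R] (n : ℕ) : Type u :=
  AddMonoidAlgebra R (Fin n → ℤ)

/-- The monomial `∏ xᵢ ^ (a i)`. -/
def monomial (R : Type u) [CommRing R] {n : ℕ} (a : Fin n → ℤ) : Laurent R n :=
  AddMonoidAlgebra.single a 1

/-- The greatest common divisor of the exponents is `1`. -/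
def IsPrimitiveExponent {n : ℕ} (a : Fin n → ℤ) : Prop :=
  Finset.univ.gcd a = 1

/-- The ideal `𝔭 A` of `A = R[x, x⁻¹]`. -/
def extendedIdeal {R : Type u} [CommRing R] (p : Ideal R) (n : ℕ) : Ideal (Laurent R n) :=
  p.map (algebraMap R (Laurent R n))

/-- The ideal `𝔮_M = (M - 1) A + 𝔭 A`, where `M = ∏ xᵢ ^ (a i)`. -/
def monomialIdeal {R : Type u} [CommRing R] (p : Ideal R) {n : ℕ} (a : Fin n → ℤ) :
    Ideal (Laurent R n) :=
  Ideal.span {monomial R a - 1} ⊔ extendedIdeal p n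

/-- A morphism `R[x₀^±, …, x_m^±] → R[y₁^±, …, y_m^±]` associated with the monomial
`∏ xᵢ ^ (a i)`: it is induced by a surjection `ℤ^(m+1) → ℤ^m` with kernel `ℤ a`. -/
def IsAssociatedMorphism {R : Type u} [CommRing R] {m : ℕ} (a : Fin (m + 1) → ℤ)
    (φ : Laurent R (m + 1) →ₐ[R] Laurent R m) : Prop :=
  ∃ f : (Fin (m + 1) → ℤ) →+ (Fin m → ℤ),
    Function.Surjective f ∧ f.ker = AddSubgroup.zmultiples a ∧
      φ = AddMonoidAlgebra.mapDomainAlgHom R R f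

theorem ker_mapRingHom_mk {R : Type u} [CommRing R] (p : Ideal R) (n : ℕ) :
    RingHom.ker (AddMonoidAlgebra.mapRingHom (Fin n → ℤ) (Ideal.Quotient.mk p)) =
      extendedIdeal p n := by
  apply le_antisymm
  · intro f hf
    have hf' : ∀ g, f.coeff g ∈ p := fun g => by
      have h := congrArg (fun x => AddMonoidAlgebra.coeff x g) ((RingHom.mem_ker).1 hf)
      simpa [Ideal.Quotient.eq_zero_iff_mem] using h
    rw [← AddMonoidAlgebra.sum_coeff_single f, Finsupp.sum]
    refine Ideal.sum_mem _ fun g _ => ?_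
    have : AddMonoidAlgebra.single g (f.coeff g) =
        (AddMonoidAlgebra.single g 1 : Laurent R n) *
          algebraMap R (Laurent R n) (f.coeff g) := by
      simp [AddMonoidAlgebra.single_mul_single]
    rw [this]
    exact Ideal.mul_mem_left _ _ (Ideal.mem_map_of_mem _ (hf' g))
  · refine Ideal.map_le_iff_le_comap.2 fun r hr => ?_
    simp [RingHom.mem_ker, Ideal.Quotient.eq_zero_iff_mem.2 hr]

theorem extendedIdeal_isPrime {R : Type u} [CommRing R] (p : Ideal R) (hp : p.IsPrime) (n : ℕ) :
    (extendedIdeal p n).IsPrime := by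
  rw [← ker_mapRingHom_mk]
  exact RingHom.ker_isPrime _

theorem monomialIdeal_isPrime {R : Type u} [CommRing R] (p : Ideal R) (hp : p.IsPrime) {n : ℕ}
    (a : Fin n → ℤ) (ha : IsPrimitiveExponent a) : (monomialIdeal p a).IsPrime := by
  obtain ⟨c, hc⟩ := Finset.gcd_eq_sum_mul Finset.univ a
  rw [ha] at hc
  let u : (Fin n → ℤ) →+ ℤ :=
    { toFun := fun g => ∑ i, g i * c i
      map_zero' := by simp
      map_add' := fun g g' => by simp [add_mul, Finset.sum_add_distrib] }
  have hu : u a = 1 := hc.symm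
  let f : (Fin n → ℤ) →+ (Fin n → ℤ) :=
    { toFun := fun g => g - u g • a
      map_zero' := by simp
      map_add' := fun g g' => by simp only [map_add, add_smul]; abel }
  have hfg : ∀ g, f g = g - u g • a := fun _ => rfl
  let σ := AddMonoidAlgebra.mapDomainRingHom R f
  let red := AddMonoidAlgebra.mapRingHom (Fin n → ℤ) (Ideal.Quotient.mk p)
  have hσ1 : ∀ g r, σ (AddMonoidAlgebra.single g r) = AddMonoidAlgebra.single (f g) r :=
    fun g r => by simp [σ]
  have key : ∀ k : ℤ, (AddMonoidAlgebra.single (k • a) 1 : Laurent R n) - 1 ∈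
      Ideal.span {monomial R a - 1} := by
    intro k
    let π := Ideal.Quotient.mk (Ideal.span {monomial R a - 1})
    let θ : Multiplicative (Fin n → ℤ) →* (Laurent R n ⧸ Ideal.span {monomial R a - 1}) :=
      (π : Laurent R n →* _).comp (AddMonoidAlgebra.of R (Fin n → ℤ))
    have h1 : θ (Multiplicative.ofAdd a) = 1 := by
      have : π (monomial R a - 1) = 0 :=
        Ideal.Quotient.eq_zero_iff_mem.2 (Ideal.subset_span rfl)
      rw [map_sub, map_one, sub_eq_zero] at this
      exact this
    have h2 : θ (Multiplicative.ofAdd (k • a)) = 1 := by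
      have h1' : θ.toHomUnits (Multiplicative.ofAdd a) = 1 := Units.ext h1
      have : θ.toHomUnits (Multiplicative.ofAdd (k • a)) = 1 := by
        rw [ofAdd_zsmul, map_zpow, h1', one_zpow]
      exact congrArg Units.val this
    apply Ideal.Quotient.eq_zero_iff_mem.1
    rw [map_sub, map_one, sub_eq_zero]
    exact h2
  have hσ : ∀ x : Laurent R n, x - σ x ∈ Ideal.span {monomial R a - 1} := by
    intro x
    induction x using AddMonoidAlgebra.induction_linear with
    | zero => simp
    | add x y hx hy =>
      rw [map_add, add_sub_add_comm]
      exact Ideal.add_mem _ hx hy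
    | single g r =>
      have : AddMonoidAlgebra.single g r - σ (AddMonoidAlgebra.single g r) =
          AddMonoidAlgebra.single (f g) r *
            ((AddMonoidAlgebra.single (u g • a) 1 : Laurent R n) - 1) := by
        rw [hσ1, mul_sub, mul_one, AddMonoidAlgebra.single_mul_single, hfg, sub_add_cancel,
          mul_one]
      rw [this]
      exact Ideal.mul_mem_left _ _ (key _)
  have hker : monomialIdeal p a = RingHom.ker (red.comp σ) := by
    apply le_antisymm
    · refine sup_le ?_ ?_
      · rw [Ideal.span_singleton_le_iff_mem, RingHom.mem_ker]
        have : σ (monomial R a) = 1 := by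
          rw [monomial, hσ1, hfg, hu, one_smul, sub_self]
          rfl
        rw [RingHom.comp_apply, map_sub, map_one, this, sub_self, map_zero]
      · refine Ideal.map_le_iff_le_comap.2 fun r hr => ?_
        have : σ (algebraMap R (Laurent R n) r) = algebraMap R (Laurent R n) r := by
          simp [σ]
        rw [Ideal.mem_comap, RingHom.mem_ker, RingHom.comp_apply, this, ← RingHom.mem_ker,
          ker_mapRingHom_mk]
        exact Ideal.mem_map_of_mem _ hr
    · intro x hx
      have h1 : σ x ∈ extendedIdeal p n := by
        rw [← ker_mapRingHom_mk]
        exact hx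
      rw [← sub_add_cancel x (σ x)]
      exact Ideal.add_mem _ (Ideal.mem_sup_left (hσ x)) (Ideal.mem_sup_right h1)
  rw [hker]
  exact RingHom.ker_isPrime _

/-! ### Split semisimple algebras and irreducible characters -/

section Characters

variable (F : Type v) [Field F] (E : Type w) [Ring E] [Algebra F E]

/-- `E` is semisimple and every endomorphism of a simple `E`-module is a scalar. -/
def IsSplitSemisimple : Prop :=
  IsSemisimpleRing E ∧
    ∀ (V : Type w) [AddCommGroup V] [Module F V] [Module E V] [IsScalarTower F E V]
      [IsSimpleModule E V] (f : V →ₗ[E] V), ∃ c : F, ∀ x : V, f x = c • x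

/-- The character of an `E`-module. -/
def moduleCharacter (V : Type w) [AddCommGroup V] [Module F V] [Module E V]
    [IsScalarTower F E V] : E →ₗ[F] F :=
  LinearMap.trace F V ∘ₗ (Algebra.lsmul F F V : E →ₐ[F] Module.End F V).toLinearMap

variable {F E} in
/-- There is a simple `E`-module with character `χ` on which `e` acts as the scalar `c`. -/
def ActsAsScalar (χ : E →ₗ[F] F) (e : E) (c : F) : Prop :=
  ∃ (V : Type w) (_ : AddCommGroup V) (_ : Module F V) (_ : Module E V)
    (_ : IsScalarTower F E V), IsSimpleModule E V ∧ moduleCharacter F E V = χ ∧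
      ∀ x : V, e • x = c • x

/-- The irreducible characters of `E`, i.e. the characters of the simple `E`-modules. -/
def Irr : Type (max v w) :=
  {χ : E →ₗ[F] F // ∃ (V : Type w) (_ : AddCommGroup V) (_ : Module F V) (_ : Module E V)
    (_ : IsScalarTower F E V), IsSimpleModule E V ∧ moduleCharacter F E V = χ}

end Characters

/-! ### Blocks -/

/-- Block-idempotents: the primitive idempotents of the center. -/
structure IsBlockIdempotent {S : Type w} [Ring S] (e : S) : Prop where
  mem_center : e ∈ Subring.center S
  idem : IsIdempotentElem e
  ne_zero : e ≠ 0
  primitive : ∀ f g : S, f ∈ Subring.center S → g ∈ Subring.center S →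
    IsIdempotentElem f → IsIdempotentElem g → f * g = 0 → e = f + g → f = 0 ∨ g = 0

section Blocks

variable (A : Type u) [CommRing A] [IsDomain A] (H : Type v) [Ring H] [Algebra A H]

/-- The algebra `F H = F ⊗ H`, where `F` is the field of fractions of `A`. -/
abbrev GenericFiber : Type (max u v) := FractionRing A ⊗[A] H

/-- The irreducible characters of `F H`. -/
abbrev IrrGeneric : Type (max u v) := Irr (FractionRing A) (GenericFiber A H)

variable {A}

/-- The inclusion of `A_𝔮` into the field of fractions of `A`. -/
def localizationToFraction (q : Ideal A) [q.IsPrime] :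
    Localization.AtPrime q →ₐ[A] FractionRing A :=
  IsLocalization.liftAlgHom (M := q.primeCompl) (f := Algebra.ofId A (FractionRing A))
    fun s => IsUnit.mk0 _ <| by
      have hs : (s : A) ≠ 0 := fun h => s.2 (h ▸ q.zero_mem)
      simpa [Algebra.ofId_apply] using hs

/-- The canonical map `A_𝔮 H → F H`. -/
def localizedToGeneric (q : Ideal A) [q.IsPrime] :
    (Localization.AtPrime q ⊗[A] H) →ₐ[A] GenericFiber A H :=
  Algebra.TensorProduct.map (localizationToFraction q) (AlgHom.id A H)

variable {H}

/-- The set `C` of irreducible characters of `F H` is a block of `A_𝔮 H`: it consists of the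
characters that belong to some block-idempotent `e` of `A_𝔮 H`, i.e. of the characters of the
simple `F H`-modules on which `e` acts as the identity. -/
def IsBlockAt (q : Ideal A) (hq : q.IsPrime) (C : Set (IrrGeneric A H)) : Prop :=
  ∃ e : Localization.AtPrime q ⊗[A] H, IsBlockIdempotent e ∧
    C = {χ | ActsAsScalar χ.1 (localizedToGeneric H q e) 1}

end Blocks

/-! ### Symmetrizing forms and Schur elements -/

section Symmetric

variable {A : Type u} [CommRing A] {H : Type v} [Ring H] [Algebra A H]

/-- A trace function `t` such that `h ↦ (x ↦ t (h x))` is an isomorphism `H ≃ Hom_A(H, A)`. -/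
structure IsSymmetrizing (t : H →ₗ[A] A) : Prop where
  trace : ∀ h k : H, t (h * k) = t (k * h)
  bijective : Function.Bijective fun h : H => (t ∘ₗ LinearMap.mulLeft A h : H →ₗ[A] A)

/-- The extension of a linear form to `F H`. -/
def extendForm [IsDomain A] (t : H →ₗ[A] A) : GenericFiber A H →ₗ[FractionRing A] FractionRing A :=
  (TensorProduct.AlgebraTensorModule.rid A (FractionRing A) (FractionRing A)).toLinearMap ∘ₗ
    t.baseChange (FractionRing A)

/-- `s` is the Schur element of `χ` with respect to `t`: the scalar by which `χ^∨` acts on a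
simple module with character `χ`, where `χ^∨` is the element with `t (χ^∨ h) = χ h` for all `h`. -/
def IsSchurElement [IsDomain A] (t : H →ₗ[A] A) (χ : IrrGeneric A H) (s : FractionRing A) : Prop :=
  ∃ c : GenericFiber A H, (∀ h, extendForm t (c * h) = χ.1 h) ∧ ActsAsScalar χ.1 c s

end Symmetric

/-! ### Essential algebras and essential monomials -/

/-- The data of an expression `ξ N ∏ᵢ Ψᵢ(Mᵢ)^{nᵢ}` of the kind required of the Schur elements
of an essential algebra. -/
structure EssentialFactorization (R : Type u) [CommRing R] [IsDomain R] (n : ℕ) where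
  /-- the coefficient -/
  ξ : R
  /-- the exponent of the monomial `N` -/
  N : Fin n → ℤ
  N_degree : ∑ j, N j = 0
  /-- the number of factors -/
  card : ℕ
  /-- the polynomials -/
  Ψ : Fin card → Polynomial R
  Ψ_monic : ∀ i, (Ψ i).Monic
  Ψ_degree : ∀ i, 1 ≤ (Ψ i).natDegree
  Ψ_irreducible : ∀ i, Irreducible ((Ψ i).map (algebraMap R (FractionRing R)))
  Ψ_coprime_X : ∀ i, IsCoprime ((Ψ i).map (algebraMap R (FractionRing R))) Polynomial.X
  Ψ_coprime_X_sub_one : ∀ i,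
    IsCoprime ((Ψ i).map (algebraMap R (FractionRing R))) (Polynomial.X - 1)
  Ψ_const : ∀ i, IsUnit ((Ψ i).coeff 0)
  /-- the exponents of the monomials `Mᵢ` -/
  M : Fin card → (Fin n → ℤ)
  M_degree : ∀ i, ∑ j, M i j = 0
  M_primitive : ∀ i, IsPrimitiveExponent (M i)
  /-- the multiplicities -/
  mult : Fin card → ℕ
  mult_pos : ∀ i, 0 < mult i

/-- The element `ξ N ∏ᵢ Ψᵢ(Mᵢ)^{nᵢ}`. -/
def EssentialFactorization.value {R : Type u} [CommRing R] [IsDomain R] {n : ℕ}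
    (d : EssentialFactorization R n) : Laurent R n :=
  algebraMap R (Laurent R n) d.ξ * monomial R d.N *
    ∏ i, (Polynomial.aeval (monomial R (d.M i)) (d.Ψ i)) ^ d.mult i

section Essential

variable {R : Type u} [CommRing R] [IsDomain R] {n : ℕ}
  {H : Type v} [Ring H] [Algebra (Laurent R n) H]

/-- `H`, with the symmetrizing form `t`, is essential. -/
def IsEssential (t : H →ₗ[Laurent R n] Laurent R n) : Prop :=
  ∀ χ : IrrGeneric (Laurent R n) H, ∃ d : EssentialFactorization R n,
    IsSchurElement t χ (algebraMap (Laurent R n) (FractionRing (Laurent R n)) d.value)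

/-- The monomial with exponent `a` is `𝔭`-essential for `χ`: it occurs as some `Mᵢ` with
`Ψᵢ(1) ∈ 𝔭` in a factorization of the Schur element of `χ`. (The `Mᵢ` are determined by the Schur
element only up to inversion, so all its factorizations are admitted.) -/
def IsEssentialMonomial (t : H →ₗ[Laurent R n] Laurent R n) (p : Ideal R) (a : Fin n → ℤ)
    (χ : IrrGeneric (Laurent R n) H) : Prop :=
  ∃ d : EssentialFactorization R n,
    IsSchurElement t χ (algebraMap (Laurent R n) (FractionRing (Laurent R n)) d.value) ∧
      ∃ i, d.M i = a ∧ (d.Ψ i).eval 1 ∈ p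

end Essential

/-! ### Specialization -/

section Specialization

variable {A : Type u} [CommRing A] {B : Type u} [CommRing B]

/-- The algebra `H_φ = B ⊗_A H` obtained from `H` via `φ : A → B`. -/
def Specialization (φ : A →+* B) (H : Type v) [Ring H] [Algebra A H] : Type (max u v) :=
  letI := φ.toAlgebra
  B ⊗[A] H

variable (φ : A →+* B) (H : Type v) [Ring H] [Algebra A H]

instance : Ring (Specialization φ H) :=
  letI := φ.toAlgebra
  (inferInstance : Ring (B ⊗[A] H))

instance : Algebra B (Specialization φ H) :=
  letI := φ.toAlgebra
  (inferInstance : Algebra B (B ⊗[A] H))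

variable {H}

/-- The canonical map `h ↦ 1 ⊗ h`. -/
def Specialization.of (h : H) : Specialization φ H :=
  letI := φ.toAlgebra
  (1 ⊗ₜ[A] h : B ⊗[A] H)

/-- `ψ` is the specialization of the character `χ` via `φ`: `χ` takes values in `A` on `H`, and
`ψ (1 ⊗ h) = φ (χ h)` for all `h` in `H`. -/
def IsSpecializedCharacter [IsDomain A] [IsDomain B] (χ : IrrGeneric A H)
    (ψ : IrrGeneric B (Specialization φ H)) : Prop :=
  ∀ h : H, ∃ x : A, χ.1 (1 ⊗ₜ[A] h) = algebraMap A (FractionRing A) x ∧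
    ψ.1 (1 ⊗ₜ[B] Specialization.of φ h) = algebraMap B (FractionRing B) (φ x)

end Specialization

end EssentialAlgebra

end

open EssentialAlgebra

/-!
A splitting of the generic fiber identifies `Irr` with the set of factors of a product of matrix
algebras, and the blocks at a prime `𝔮` become the minimal nonempty sets of factors whose central
idempotent is, up to a denominator outside of `𝔮`, an element of `H`.

By Schur's relations such an idempotent has a product of Schur elements as a denominator. When `M`
is not `𝔭`-essential, the factors `Ψ(M')` of these Schur elements do not lie in `𝔮_M`: for
`M' ≠ M^{±1}` the monomials `M'` and `M` are independent, and for `M' = M^{±1}` the factor is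
congruent to `Ψ(1)` modulo `M - 1`, where `M' = M⁻¹` is turned into `M` by passing to the reciprocal
polynomial of `Ψ`. An idempotent that has a denominator outside of `𝔭A` therefore has one outside of
`𝔮_M`.

For the specialized algebra, the local ring of `A` at the prime `(M - 1)` is principal, so the
splitting can be chosen to come from an isomorphism with a product of matrix algebras over this
ring, and it specializes along `φ_M` to a splitting of `H_φ`. An idempotent of `H_φ` that is defined
at `𝔭B` lifts to an element that is idempotent and central modulo `𝔮_M`. The eigenvalues of this
element are integral over the integrally closed local ring `A_{𝔮_M}`, and on every factor they are
all congruent to `0` or all congruent to `1` in a dominating valuation ring, which yields a central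
idempotent at `𝔮_M` with the given specialization.
-/

noncomputable section

namespace EssentialAlgebra

universe u v w

/-! ### Split semisimple algebras as products of matrix algebras -/

/-- The product of the full matrix algebras of sizes `d i` over `K`. -/
abbrev MatrixProd {ι : Type*} (d : ι → ℕ) (K : Type*) : Type _ :=
  ∀ i, Matrix (Fin (d i)) (Fin (d i)) K

theorem IsSplitSemisimple.exists_algEquiv_matrixProd {F : Type v} [Field F] {E : Type w} [Ring E]
    [Algebra F E] (h : IsSplitSemisimple F E) :
    ∃ (n : ℕ) (d : Fin n → ℕ), (∀ i, NeZero (d i)) ∧ Nonempty (E ≃ₐ[F] MatrixProd d F) := by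
  have := h.1
  obtain ⟨n, S, d, hS, hd, ⟨e⟩⟩ := IsSemisimpleRing.exists_algEquiv_pi_matrix_end_mulOpposite F E
  have hend (i : Fin n) : Function.Bijective (Algebra.ofId F (Module.End E (S i))ᵐᵒᵖ) := by
    have := hS i
    have := IsSimpleModule.nontrivial E (S i)
    refine ⟨(algebraMap F (Module.End E (S i))ᵐᵒᵖ).injective, fun f => ?_⟩
    obtain ⟨c, hc⟩ := h.2 (S i) f.unop
    exact ⟨c, MulOpposite.unop_injective (LinearMap.ext fun x => (hc x).symm)⟩
  exact ⟨n, d, hd, ⟨e.trans (AlgEquiv.piCongrRight fun i =>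
    (AlgEquiv.ofBijective _ (hend i)).symm.mapMatrix)⟩⟩

section Columns

variable {F : Type v} [Field F] {E : Type (max v w)} [Ring E] [Algebra F E]
  {ι : Type*} {d : ι → ℕ} (Φ : E ≃ₐ[F] MatrixProd d F)

/-- The module of column vectors of the `i`-th factor, lifted to the universe of `E`. -/
def Column (_ : E ≃ₐ[F] MatrixProd d F) (i : ι) : Type (max v w) := ULift.{w} (Fin (d i) → F)

instance (i : ι) : AddCommGroup (Column.{v, w} Φ i) :=
  inferInstanceAs (AddCommGroup (ULift.{w} (Fin (d i) → F)))

instance (i : ι) : Module F (Column.{v, w} Φ i) :=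
  inferInstanceAs (Module F (ULift.{w} (Fin (d i) → F)))

/-- The underlying vector space of a column module. -/
def columnEquiv (i : ι) : Column.{v, w} Φ i ≃ₗ[F] (Fin (d i) → F) :=
  ULift.moduleEquiv

instance (i : ι) : Module E (Column.{v, w} Φ i) :=
  Module.compHom _ (((columnEquiv Φ i).symm.conjAlgEquiv F).toRingHom.comp
    ((Matrix.toLinAlgEquiv' : _ ≃ₐ[F] _).toRingHom.comp ((Pi.evalRingHom _ i).comp Φ.toRingHom)))

theorem columnEquiv_smul (i : ι) (x : E) (c : Column.{v, w} Φ i) :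
    columnEquiv Φ i (x • c) = (Φ x i).mulVec (columnEquiv Φ i c) :=
  (columnEquiv Φ i).apply_symm_apply _

instance (i : ι) : IsScalarTower F E (Column.{v, w} Φ i) :=
  ⟨fun r x c => (columnEquiv Φ i).injective <| by
    simp only [columnEquiv_smul, map_smul, Pi.smul_apply, Matrix.smul_mulVec]⟩

theorem moduleCharacter_column (i : ι) (x : E) :
    moduleCharacter F E (Column.{v, w} Φ i) x = (Φ x i).trace := by
  rw [← Matrix.trace_toLin'_eq]
  change LinearMap.trace F _ _ = _
  rw [← LinearMap.trace_conj' _ (columnEquiv Φ i)]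
  congr 1

theorem moduleCharacter_congr {V W : Type (max v w)} [AddCommGroup V] [Module F V] [Module E V]
    [IsScalarTower F E V] [AddCommGroup W] [Module F W] [Module E W] [IsScalarTower F E W]
    (e : V ≃ₗ[E] W) : moduleCharacter F E V = moduleCharacter F E W := by
  refine LinearMap.ext fun x => ?_
  change LinearMap.trace F V _ = LinearMap.trace F W _
  rw [← LinearMap.trace_conj' _ (e.restrictScalars F)]
  congr 1
  refine LinearMap.ext fun c => ?_
  simp [LinearEquiv.conj_apply]

instance (i : ι) [NeZero (d i)] : IsSimpleModule E (Column.{v, w} Φ i) := by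
  classical
  rw [isSimpleModule_iff_toSpanSingleton_surjective]
  refine ⟨(columnEquiv Φ i).toEquiv.nontrivial, fun c hc c' => ?_⟩
  obtain ⟨j, hj⟩ : ∃ j, columnEquiv Φ i c j ≠ 0 := by
    by_contra! h
    exact hc ((columnEquiv Φ i).injective (by ext j; simpa using h j))
  refine ⟨Φ.symm (Pi.single i (Matrix.vecMulVec (columnEquiv Φ i c')
    (Pi.single j (columnEquiv Φ i c j)⁻¹))), (columnEquiv Φ i).injective ?_⟩
  rw [LinearMap.toSpanSingleton_apply, columnEquiv_smul, AlgEquiv.apply_symm_apply,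
    Pi.single_eq_same]
  ext k
  simp [Matrix.vecMulVec_mulVec, hj]

theorem exists_symm_single_smul_ne_zero [Finite ι] [DecidableEq ι]
    {V : Type*} [AddCommGroup V] [Module E V] {v : V} (hv : v ≠ 0) :
    ∃ i j, Φ.symm (Pi.single i (Matrix.single j j 1)) • v ≠ 0 := by
  cases nonempty_fintype ι
  by_contra! h
  have hone : (1 : E) = ∑ i, ∑ j, Φ.symm (Pi.single i (Matrix.single j j 1)) := by
    rw [← map_one Φ.symm, ← Finset.univ_sum_single (1 : MatrixProd d F), map_sum]
    refine Finset.sum_congr rfl fun i _ => ?_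
    rw [← map_sum, Pi.one_apply, ← Matrix.sum_single_one]
    exact congrArg _ (map_sum (AddMonoidHom.single _ i) _ _)
  apply hv
  rw [← one_smul E v, hone]
  simp only [Finset.sum_smul, h, Finset.sum_const_zero]

theorem exists_column_linearEquiv [Finite ι] [∀ i, NeZero (d i)] (V : Type*) [AddCommGroup V]
    [Module E V] [IsSimpleModule E V] : ∃ i, Nonempty (Column.{v, w} Φ i ≃ₗ[E] V) := by
  classical
  have := IsSimpleModule.nontrivial E V
  obtain ⟨v, hv⟩ := exists_ne (0 : V)
  obtain ⟨i, j, hij⟩ := exists_symm_single_smul_ne_zero Φ hv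
  let f : Column.{v, w} Φ i →ₗ[E] V :=
    { toFun := fun c =>
        Φ.symm (Pi.single i (Matrix.vecMulVec (columnEquiv Φ i c) (Pi.single j 1))) • v
      map_add' := fun c c' => by
        rw [map_add, Matrix.add_vecMulVec, Pi.single_add, map_add, add_smul]
      map_smul' := fun x c => by
        rw [columnEquiv_smul, ← Matrix.mul_vecMulVec, RingHom.id_apply, ← mul_smul]
        congr 1
        apply Φ.injective
        ext k : 1
        rcases eq_or_ne k i with rfl | hk
        · simp
        · simp [hk] }
  refine ⟨i, ⟨LinearEquiv.ofBijective f (LinearMap.bijective_of_ne_zero fun h0 => hij ?_)⟩⟩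
  have := LinearMap.congr_fun h0 ((columnEquiv Φ i).symm (Pi.single j 1))
  simpa [f, Matrix.single_eq_single_vecMulVec_single] using this

variable [Finite ι] [∀ i, NeZero (d i)]

/-- The irreducible characters of a product of matrix algebras, indexed by its factors: the
character attached to a factor is the trace on it. -/
def irrEquiv : ι ≃ Irr.{v, max v w} F E :=
  Equiv.ofBijective
    (fun i => ⟨moduleCharacter F E (Column.{v, w} Φ i), Column.{v, w} Φ i, inferInstance,
      inferInstance, inferInstance, inferInstance, inferInstance, rfl⟩) <| by
    classical
    constructor
    · intro i j hij
      by_contra hne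
      have h := LinearMap.congr_fun (congrArg Subtype.val hij)
        (Φ.symm (Pi.single i (Matrix.single 0 0 1)))
      simp [moduleCharacter_column, Ne.symm hne] at h
    · rintro ⟨χ, V, _, _, _, _, _, rfl⟩
      obtain ⟨i, ⟨e⟩⟩ := exists_column_linearEquiv Φ V
      exact ⟨i, Subtype.ext (moduleCharacter_congr e)⟩

theorem irrEquiv_apply (i : ι) (x : E) : (irrEquiv Φ i).1 x = (Φ x i).trace :=
  moduleCharacter_column Φ i x

theorem actsAsScalar_irrEquiv_iff (i : ι) (x : E) (c : F) :
    ActsAsScalar (irrEquiv Φ i).1 x c ↔ Φ x i = c • 1 := by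
  constructor
  · rintro ⟨V, _, _, _, _, _, hχ, hx⟩
    obtain ⟨j, ⟨e⟩⟩ := exists_column_linearEquiv Φ V
    obtain rfl : j = i := (irrEquiv Φ).injective
      (Subtype.ext ((moduleCharacter_congr e).trans hχ))
    have h (w : Fin (d j) → F) : (Φ x j).mulVec w = c • w := by
      have hw : x • (columnEquiv Φ j).symm w = c • (columnEquiv Φ j).symm w :=
        e.injective <| by
          rw [e.map_smul, hx]
          exact ((e.restrictScalars F).map_smul c _).symm
      simpa [columnEquiv_smul] using congrArg (columnEquiv Φ j) hw
    refine Matrix.ext_of_mulVec_single fun k => ?_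
    rw [h, Matrix.smul_mulVec, Matrix.one_mulVec]
  · intro h
    refine ⟨Column.{v, w} Φ i, inferInstance, inferInstance, inferInstance, inferInstance,
      inferInstance, rfl, fun z => (columnEquiv Φ i).injective ?_⟩
    rw [columnEquiv_smul, h, Matrix.smul_mulVec, Matrix.one_mulVec, map_smul]

end Columns

/-! ### Central idempotents of a product of matrix algebras -/

section UnitOn

variable {ι : Type*} (d : ι → ℕ) (K : Type*) [CommRing K]

open Classical in
/-- The central idempotent of a product of matrix algebras attached to a set of factors: the unit
on these factors and `0` on the others. -/
def unitOn (S : Set ι) : MatrixProd d K := fun i => if i ∈ S then 1 else 0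

variable {d K}

theorem unitOn_apply_of_mem {S : Set ι} {i : ι} (hi : i ∈ S) : unitOn d K S i = 1 := if_pos hi

theorem unitOn_apply_of_notMem {S : Set ι} {i : ι} (hi : i ∉ S) : unitOn d K S i = 0 := if_neg hi

theorem unitOn_mul (S T : Set ι) : unitOn d K S * unitOn d K T = unitOn d K (S ∩ T) := by
  ext i : 1
  by_cases hS : i ∈ S <;> by_cases hT : i ∈ T <;> simp [unitOn, hS, hT]

theorem unitOn_commute (S : Set ι) (x : MatrixProd d K) : Commute (unitOn d K S) x := by
  refine funext fun i => ?_
  by_cases hS : i ∈ S <;> simp [unitOn, hS]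

theorem unitOn_empty : unitOn d K ∅ = 0 := by
  ext i : 1
  simp [unitOn]

theorem unitOn_union_of_disjoint {S T : Set ι} (h : Disjoint S T) :
    unitOn d K (S ∪ T) = unitOn d K S + unitOn d K T := by
  ext i : 1
  have := (fun j hj => Set.disjoint_left.1 h hj : ∀ j, j ∈ S → j ∉ T) i
  by_cases hS : i ∈ S <;> by_cases hT : i ∈ T <;> simp_all [unitOn]

theorem unitOn_injective [Nontrivial K] [∀ i, NeZero (d i)] :
    Function.Injective (unitOn d K) := by
  intro S T h
  ext i
  have := congrFun h i
  by_cases hS : i ∈ S <;> by_cases hT : i ∈ T <;> simp_all [unitOn]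

theorem exists_eq_unitOn [IsDomain K] {x : MatrixProd d K} (hc : ∀ y, Commute x y)
    (hx : IsIdempotentElem x) : ∃ S, x = unitOn d K S := by
  classical
  have h01 (i : ι) : x i = 0 ∨ x i = 1 := by
    obtain ⟨c, hc⟩ : x i ∈ Set.range (Matrix.scalar (Fin (d i))) :=
      Matrix.mem_range_scalar_of_commute_single fun j k _ => by
        have := congrFun (hc (Pi.single i (Matrix.single j k 1))).eq i
        rw [Pi.mul_apply, Pi.mul_apply, Pi.single_eq_same] at this
        exact this.symm
    rcases isEmpty_or_nonempty (Fin (d i)) with _ | ⟨⟨j⟩⟩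
    · exact Or.inl (Subsingleton.elim _ _)
    have hidem : x i * x i = x i := congrFun hx i
    rw [← hc, ← map_mul] at hidem
    have hcc : c * c = c := by simpa using congrFun (congrFun hidem j) j
    rw [← hc]
    exact (IsIdempotentElem.iff_eq_zero_or_one.1 hcc).imp (by simp +contextual)
      (by simp +contextual)
  refine ⟨{i | x i = 1}, funext fun i => ?_⟩
  by_cases hi : x i = 1
  · rw [unitOn_apply_of_mem (by exact hi), hi]
  · rw [unitOn_apply_of_notMem (by exact hi), (h01 i).resolve_right hi]

end UnitOn

theorem commute_of_span_eq_top {K E : Type*} [CommSemiring K] [Semiring E] [Algebra K E]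
    {s : Set E} (hs : Submodule.span K s = ⊤) {x : E} (hx : ∀ y ∈ s, Commute x y) (y : E) :
    Commute x y := by
  induction (hs ▸ Submodule.mem_top : y ∈ Submodule.span K s) using Submodule.span_induction with
  | mem y hy => exact hx y hy
  | zero => exact Commute.zero_right x
  | add y z _ _ hy hz => exact hy.add_right hz
  | smul a y _ hy => exact hy.smul_right a

section BlockIdempotents

variable {K : Type*} [CommRing K] {ι : Type*} {d : ι → ℕ} {Λ : Type*} [Ring Λ]
  {ρ : Λ →+* MatrixProd d K}

theorem mem_center_of_map_eq_unitOn (hρ : Function.Injective ρ) {e : Λ} {S : Set ι}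
    (he : ρ e = unitOn d K S) : e ∈ Subring.center Λ :=
  Subring.mem_center_iff.2 fun g => hρ <| by
    rw [map_mul, map_mul, he, (unitOn_commute S _).eq]

theorem isIdempotentElem_of_map_eq_unitOn (hρ : Function.Injective ρ) {e : Λ} {S : Set ι}
    (he : ρ e = unitOn d K S) : IsIdempotentElem e :=
  hρ <| by rw [map_mul, he, unitOn_mul, Set.inter_self]

theorem exists_map_eq_unitOn [IsDomain K] (hspan : Submodule.span K (Set.range ρ) = ⊤) {e : Λ}
    (hc : e ∈ Subring.center Λ) (he : IsIdempotentElem e) : ∃ S, ρ e = unitOn d K S := by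
  refine exists_eq_unitOn (commute_of_span_eq_top hspan ?_) (he.map ρ)
  rintro _ ⟨x, rfl⟩
  exact Commute.map (Subring.mem_center_iff.1 hc x).symm ρ

variable [∀ i, NeZero (d i)]

theorem ne_zero_iff_nonempty_of_map_eq_unitOn [Nontrivial K] (hρ : Function.Injective ρ) {e : Λ}
    {S : Set ι} (he : ρ e = unitOn d K S) : e ≠ 0 ↔ S.Nonempty := by
  rw [Set.nonempty_iff_ne_empty, ← hρ.ne_iff, he, map_zero, ← unitOn_empty, unitOn_injective.ne_iff]

theorem IsBlockIdempotent.minimal [Nontrivial K] (hρ : Function.Injective ρ) {e : Λ} {S : Set ι}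
    (he : IsBlockIdempotent e) (hS : ρ e = unitOn d K S) :
    Minimal (fun T : Set ι => T.Nonempty ∧ ∃ f, ρ f = unitOn d K T) S := by
  refine ⟨⟨(ne_zero_iff_nonempty_of_map_eq_unitOn hρ hS).1 he.ne_zero, e, hS⟩, ?_⟩
  rintro T ⟨hT, f, hf⟩ hTS
  have hg : ρ (e - f) = unitOn d K (S \ T) := by
    rw [map_sub, hS, hf, sub_eq_iff_eq_add, ← unitOn_union_of_disjoint Set.disjoint_sdiff_left,
      Set.sdiff_union_of_subset hTS]
  have hfg : f * (e - f) = 0 := hρ <| by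
    rw [map_mul, hf, hg, unitOn_mul, Set.inter_sdiff_self, unitOn_empty, map_zero]
  have hg0 : e - f = 0 := (he.primitive f (e - f) (mem_center_of_map_eq_unitOn hρ hf)
    (mem_center_of_map_eq_unitOn hρ hg) (isIdempotentElem_of_map_eq_unitOn hρ hf)
    (isIdempotentElem_of_map_eq_unitOn hρ hg) hfg (add_sub_cancel f e).symm).resolve_left
    ((ne_zero_iff_nonempty_of_map_eq_unitOn hρ hf).2 hT)
  by_contra hST
  exact (ne_zero_iff_nonempty_of_map_eq_unitOn hρ hg).2 (Set.sdiff_nonempty.2 hST) hg0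

theorem isBlockIdempotent_of_minimal [IsDomain K] (hρ : Function.Injective ρ)
    (hspan : Submodule.span K (Set.range ρ) = ⊤) {e : Λ} {S : Set ι} (he : ρ e = unitOn d K S)
    (hS : Minimal (fun T : Set ι => T.Nonempty ∧ ∃ f, ρ f = unitOn d K T) S) :
    IsBlockIdempotent e where
  mem_center := mem_center_of_map_eq_unitOn hρ he
  idem := isIdempotentElem_of_map_eq_unitOn hρ he
  ne_zero := (ne_zero_iff_nonempty_of_map_eq_unitOn hρ he).2 hS.prop.1
  primitive f g hfc hgc hf hg hfg hefg := by
    obtain ⟨T, hT⟩ := exists_map_eq_unitOn hspan hfc hf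
    obtain ⟨U, hU⟩ := exists_map_eq_unitOn hspan hgc hg
    have hTU : Disjoint T U := Set.disjoint_iff_inter_eq_empty.2 <| unitOn_injective (K := K) <| by
      rw [← unitOn_mul, ← hT, ← hU, ← map_mul, hfg, map_zero, unitOn_empty]
    have hTUS : T ∪ U = S := unitOn_injective (K := K) <| by
      rw [unitOn_union_of_disjoint hTU, ← hT, ← hU, ← map_add, ← hefg, he]
    by_contra! h
    have hST : S ⊆ T := hS.le_of_le
      ⟨(ne_zero_iff_nonempty_of_map_eq_unitOn hρ hT).1 h.1, f, hT⟩ (hTUS ▸ Set.subset_union_left)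
    obtain ⟨i, hi⟩ := (ne_zero_iff_nonempty_of_map_eq_unitOn hρ hU).1 h.2
    exact Set.disjoint_left.1 hTU (hST (hTUS ▸ Or.inr hi)) hi

end BlockIdempotents

/-! ### Blocks of the localizations of an algebra -/

section BaseChange

/-- The extension of a representation of `H` to a base change of `H`. -/
def liftRep {A O H E : Type*} [CommRing A] [CommRing O] [Algebra A O] [Ring H] [Algebra A H]
    [Ring E] [Algebra A E] [Algebra O E] [IsScalarTower A O E] (ρ : H →ₐ[A] E) :
    O ⊗[A] H →ₐ[O] E :=
  Algebra.TensorProduct.lift (Algebra.ofId O E) ρ fun x y => by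
    rw [Algebra.ofId_apply]
    exact Algebra.commute_algebraMap_left x (ρ y)

theorem liftRep_tmul {A O H E : Type*} [CommRing A] [CommRing O] [Algebra A O] [Ring H]
    [Algebra A H] [Ring E] [Algebra A E] [Algebra O E] [IsScalarTower A O E] (ρ : H →ₐ[A] E)
    (x : O) (h : H) : liftRep ρ (x ⊗ₜ[A] h) = x • ρ h := by
  rw [liftRep, Algebra.TensorProduct.lift_tmul, Algebra.smul_def, Algebra.ofId_apply]

theorem exists_smul_eq_one_tmul {A S H : Type*} [CommRing A] [CommRing S] [Algebra A S]
    [AddCommGroup H] [Module A H] (M : Submonoid A) [IsLocalization M S] (e : S ⊗[A] H) :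
    ∃ s ∈ M, ∃ h : H, s • e = 1 ⊗ₜ h := by
  obtain ⟨⟨h, s⟩, hs⟩ := IsLocalizedModule.surj M (TensorProduct.mk A S H 1) e
  exact ⟨s, s.2, h, hs⟩

end BaseChange

section Localization

variable {A : Type u} [CommRing A] [IsDomain A]

instance (q : Ideal A) [q.IsPrime] : Algebra (Localization.AtPrime q) (FractionRing A) :=
  (localizationToFraction q).toAlgebra

instance (q : Ideal A) [q.IsPrime] :
    IsScalarTower A (Localization.AtPrime q) (FractionRing A) :=
  .of_algHom (localizationToFraction q)

instance (q : Ideal A) [q.IsPrime] : IsFractionRing (Localization.AtPrime q) (FractionRing A) :=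
  IsFractionRing.isFractionRing_of_isDomain_of_isLocalization q.primeCompl _ _

instance [IsIntegrallyClosed A] (q : Ideal A) [q.IsPrime] :
    IsIntegrallyClosed (Localization.AtPrime q) :=
  isIntegrallyClosed_of_isLocalization _ q.primeCompl q.primeCompl_le_nonZeroDivisors

variable {H : Type v} [Ring H] [Algebra A H]

theorem localizedToGeneric_injective [Module.Flat A H] (q : Ideal A) [q.IsPrime] :
    Function.Injective (localizedToGeneric H q) :=
  Module.Flat.rTensor_preserves_injective_linearMap (M := H)
    (localizationToFraction q).toLinearMap
    (IsFractionRing.injective (Localization.AtPrime q) (FractionRing A))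

end Localization

section Rep

variable {A : Type u} [CommRing A] {H : Type v} [Ring H] [Algebra A H] {ι : Type*} {d : ι → ℕ}
  (Φ : GenericFiber A H ≃ₐ[FractionRing A] MatrixProd d (FractionRing A))

/-- The representation of `H` by matrices over the field of fractions of `A` given by a splitting
of the generic fiber. -/
def rep : H →ₐ[A] MatrixProd d (FractionRing A) :=
  (Φ.toAlgHom.restrictScalars A).comp Algebra.TensorProduct.includeRight

theorem rep_apply (h : H) : rep Φ h = Φ (1 ⊗ₜ h) := rfl

theorem rep_eq_smul_iff {h : H} {v : A} {x : MatrixProd d (FractionRing A)} :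
    rep Φ h = v • x ↔ v • Φ.symm x = 1 ⊗ₜ h := by
  rw [rep_apply, ← AlgEquiv.eq_symm_apply, ← algebraMap_smul (FractionRing A) v x, map_smul,
    algebraMap_smul, eq_comm]

theorem rep_injective [Module.Flat A H] : Function.Injective (rep Φ) :=
  Φ.injective.comp
    (Algebra.TensorProduct.includeRight_injective (IsFractionRing.injective A (FractionRing A)))

variable [IsDomain A]

theorem span_range_rep : Submodule.span (FractionRing A) (Set.range (rep Φ)) = ⊤ := by
  refine eq_top_iff.2 fun y _ => ?_
  obtain ⟨s, hs, h, hh⟩ := exists_smul_eq_one_tmul (nonZeroDivisors A) (Φ.symm y)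
  have hs0 : algebraMap A (FractionRing A) s ≠ 0 := by simpa using nonZeroDivisors.ne_zero hs
  have hy : y = (algebraMap A (FractionRing A) s)⁻¹ • rep Φ h := by
    rw [rep_apply, ← hh, ← algebraMap_smul (FractionRing A) s, map_smul, smul_smul,
      inv_mul_cancel₀ hs0, one_smul, AlgEquiv.apply_symm_apply]
  exact hy ▸ Submodule.smul_mem _ _ (Submodule.subset_span ⟨h, rfl⟩)

/-- The matrices of the elements of the localization of `H` at `q`. -/
abbrev localizedRep (q : Ideal A) [q.IsPrime] :
    Localization.AtPrime q ⊗[A] H →ₐ[Localization.AtPrime q] MatrixProd d (FractionRing A) :=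
  liftRep (rep Φ)

theorem localizedRep_apply (q : Ideal A) [q.IsPrime] (e : Localization.AtPrime q ⊗[A] H) :
    localizedRep Φ q e = Φ (localizedToGeneric H q e) := by
  induction e with
  | zero => simp only [map_zero]
  | add x y hx hy => simp only [map_add, hx, hy]
  | tmul x h =>
    have hx : localizedToGeneric H q (x ⊗ₜ h) =
        algebraMap (Localization.AtPrime q) (FractionRing A) x •
          ((1 : FractionRing A) ⊗ₜ[A] h) := by
      rw [TensorProduct.smul_tmul', smul_eq_mul, mul_one]
      rfl
    rw [liftRep_tmul, hx, map_smul, algebraMap_smul, rep_apply]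

theorem localizedRep_injective [Module.Flat A H] (q : Ideal A) [q.IsPrime] :
    Function.Injective (localizedRep Φ q) := fun x y h =>
  localizedToGeneric_injective q <| Φ.injective <| by
    rw [← localizedRep_apply, h, localizedRep_apply]

theorem span_range_localizedRep (q : Ideal A) [q.IsPrime] :
    Submodule.span (FractionRing A) (Set.range (localizedRep Φ q)) = ⊤ := by
  refine eq_top_iff.2 ((span_range_rep Φ).ge.trans (Submodule.span_mono ?_))
  rintro _ ⟨h, rfl⟩
  exact ⟨1 ⊗ₜ h, by rw [liftRep_tmul, one_smul]⟩

end Rep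

/-- `S` is a union of blocks at `q`: the central idempotent attached to `S` lies in the
localization at `q` of the image of `ρ`. -/
def IsBlockUnionAt {A K H ι : Type*} [CommRing A] [CommRing K] [Algebra A K] [Ring H]
    [Algebra A H] {d : ι → ℕ} (ρ : H →ₐ[A] MatrixProd d K) (q : Ideal A) (S : Set ι) : Prop :=
  ∃ v ∉ q, ∃ h, ρ h = v • unitOn d K S

section Blocks

variable {A : Type u} [CommRing A] [IsDomain A] {H : Type v} [Ring H] [Algebra A H] {ι : Type*}
  {d : ι → ℕ} (Φ : GenericFiber A H ≃ₐ[FractionRing A] MatrixProd d (FractionRing A))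

theorem isBlockUnionAt_iff_exists_localizedRep (q : Ideal A) [q.IsPrime] (S : Set ι) :
    IsBlockUnionAt (rep Φ) q S ↔ ∃ e, localizedRep Φ q e = unitOn d _ S := by
  constructor
  · rintro ⟨v, hv, h, hh⟩
    let s : q.primeCompl := ⟨v, hv⟩
    have hs : IsLocalization.mk' (Localization.AtPrime q) 1 s *
        algebraMap A (Localization.AtPrime q) v = 1 :=
      (IsLocalization.mk'_spec (Localization.AtPrime q) 1 s).trans (map_one _)
    exact ⟨IsLocalization.mk' _ 1 s ⊗ₜ h, by
      rw [liftRep_tmul, hh, ← algebraMap_smul (Localization.AtPrime q) v, smul_smul, hs, one_smul]⟩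
  · rintro ⟨e, he⟩
    obtain ⟨v, hv, h, hh⟩ := exists_smul_eq_one_tmul q.primeCompl e
    refine ⟨v, hv, h, ?_⟩
    rw [← he, ← one_smul (Localization.AtPrime q) (rep Φ h), ← liftRep_tmul, ← hh,
      ← algebraMap_smul (Localization.AtPrime q), map_smul, algebraMap_smul]

variable [Module.Flat A H] [Finite ι] [∀ i, NeZero (d i)]

theorem isBlockAt_iff_minimal (q : Ideal A) (hq : q.IsPrime) (C : Set (IrrGeneric A H)) :
    IsBlockAt q hq C ↔
      Minimal (fun T => T.Nonempty ∧ IsBlockUnionAt (rep Φ) q T) (irrEquiv.{u, v} Φ ⁻¹' C) := by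
  simp only [isBlockUnionAt_iff_exists_localizedRep]
  have hinj := localizedRep_injective Φ q
  have hspan := span_range_localizedRep Φ q
  have hact {S : Set ι} {e : Localization.AtPrime q ⊗[A] H}
      (he : localizedRep Φ q e = unitOn d _ S) :
      irrEquiv.{u, v} Φ ⁻¹' {χ | ActsAsScalar χ.1 (localizedToGeneric H q e) 1} = S := by
    ext i
    rw [Set.mem_preimage, Set.mem_ofPred_eq, actsAsScalar_irrEquiv_iff, ← localizedRep_apply, he,
      one_smul]
    by_cases hi : i ∈ S <;> simp [unitOn, hi]
  constructor
  · rintro ⟨e, he, rfl⟩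
    obtain ⟨S, hS⟩ := exists_map_eq_unitOn (ρ := (localizedRep Φ q).toRingHom) hspan
      he.mem_center he.idem
    rw [hact hS]
    exact he.minimal hinj hS
  · intro hC
    obtain ⟨e, he⟩ := hC.prop.2
    exact ⟨e, isBlockIdempotent_of_minimal (ρ := (localizedRep Φ q).toRingHom) hinj hspan he hC,
      (irrEquiv.{u, v} Φ).surjective.preimage_injective (hact he).symm⟩

end Blocks

/-! ### Lifting central idempotents -/

section IdealMultiples

open Polynomial

theorem tmul_mem_smul_top {O V Λ : Type*} [CommRing O] [CommRing V] [Algebra O V]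
    [Ring Λ] [Algebra O Λ] {I : Ideal O} {y : Λ} (hy : y ∈ I • (⊤ : Submodule O Λ)) (v : V) :
    v ⊗ₜ[O] y ∈ I.map (algebraMap O V) • (⊤ : Submodule V (V ⊗[O] Λ)) := by
  refine Submodule.smul_induction_on hy (fun r hr n _ => ?_) fun x y hx hy => ?_
  · rw [TensorProduct.tmul_smul, ← algebraMap_smul V r]
    exact Submodule.smul_mem_smul (Ideal.mem_map_of_mem _ hr) trivial
  · rw [TensorProduct.tmul_add]
    exact add_mem hx hy

variable {V Λ : Type*} [CommRing V] [Ring Λ] [Algebra V Λ] {I : Ideal V}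

theorem mul_right_mem_smul_top {y : Λ} (hy : y ∈ I • (⊤ : Submodule V Λ)) (x : Λ) :
    y * x ∈ I • (⊤ : Submodule V Λ) := by
  have h := Submodule.mem_map_of_mem (f := LinearMap.mulRight V x) hy
  rw [Submodule.map_smul''] at h
  exact Submodule.smul_mono le_rfl le_top h

theorem mul_left_mem_smul_top {y : Λ} (hy : y ∈ I • (⊤ : Submodule V Λ)) (x : Λ) :
    x * y ∈ I • (⊤ : Submodule V Λ) := by
  have h := Submodule.mem_map_of_mem (f := LinearMap.mulLeft V x) hy
  rw [Submodule.map_smul''] at h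
  exact Submodule.smul_mono le_rfl le_top h

theorem exists_monic_isWeaklyEisensteinAt_aeval_eq_zero [Module.Finite V Λ] {y : Λ}
    (hy : y ∈ I • (⊤ : Submodule V Λ)) :
    ∃ p : V[X], p.Monic ∧ p.IsWeaklyEisensteinAt I ∧ aeval y p = 0 := by
  obtain ⟨p, hp, -, hI, h0⟩ :=
    LinearMap.exists_monic_and_natDegree_eq_and_coeff_mem_pow_and_aeval_eq_zero
      V (Algebra.lmul V Λ y) I (by
        rintro _ ⟨x, rfl⟩
        exact mul_right_mem_smul_top hy x)
  refine ⟨p, hp, ⟨fun hk => Ideal.pow_le_self (by omega) (hI _)⟩, ?_⟩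
  rw [aeval_algHom_apply] at h0
  simpa using LinearMap.congr_fun h0 1

theorem mem_of_algebraMap_mem_spectrum [I.IsPrime] [Module.Finite V Λ] {K B : Type*} [Field K]
    [Algebra V K] [FaithfulSMul V K] [Ring B] [Algebra K B] [Algebra V B] [IsScalarTower V K B]
    (θ : Λ →ₐ[V] B) {g : Λ} (hg : g ∈ I • (⊤ : Submodule V Λ)) {l : V}
    (hl : algebraMap V K l ∈ spectrum K (θ g)) : l ∈ I := by
  obtain ⟨p, hp, hpI, hpg⟩ := exists_monic_isWeaklyEisensteinAt_aeval_eq_zero hg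
  have : Nontrivial B := by
    by_contra h
    rw [not_nontrivial_iff_subsingleton] at h
    simp [spectrum.of_subsingleton] at hl
  have hθ : aeval (θ g) (p.map (algebraMap V K)) = 0 := by
    rw [aeval_map_algebraMap, aeval_algHom_apply, hpg, map_zero]
  have heval : (p.map (algebraMap V K)).eval (algebraMap V K l) ∈ spectrum K _ :=
    spectrum.subset_polynomial_aeval (θ g) _ ⟨_, hl, rfl⟩
  rw [hθ, spectrum.zero_eq, Set.mem_singleton_iff, eval_map_algebraMap,
    aeval_algebraMap_apply_eq_algebraMap_eval] at heval
  have hroot : p.IsRoot l := (FaithfulSMul.algebraMap_eq_zero_iff V K).1 heval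
  exact Ideal.IsPrime.mem_of_pow_mem ‹_› _
    (hpI.pow_natDegree_le_of_root_of_monic_mem hroot hp _ le_rfl)

end IdealMultiples

section Polynomials

open Polynomial IsLocalRing

theorem exists_eq_X_add_mul {R : Type*} [CommRing R] {Q : R[X]} (h0 : Q.eval 0 = 0)
    (h1 : Q.eval 1 = 1) : ∃ G : R[X], Q = X + (X ^ 2 - X) * G := by
  obtain ⟨Q', rfl⟩ := X_dvd_iff.2 (by rwa [coeff_zero_eq_eval_zero] : Q.coeff 0 = 0)
  have h2 : (Q' - 1).eval 1 = 0 := by simp_all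
  obtain ⟨G, hG⟩ := dvd_iff_isRoot.2 h2
  refine ⟨G, ?_⟩
  rw [sub_eq_iff_eq_add.1 hG, C_1]
  ring

theorem isCoprime_of_isCoprime_map {R S : Type*} [CommRing R] [CommRing S] [Nontrivial S]
    (φ : R →+* S) [IsLocalHom φ] {a b : R[X]} (ha : a.Monic) (hb : b.Monic)
    (h : IsCoprime (a.map φ) (b.map φ)) : IsCoprime a b := by
  rw [← isUnit_resultant_iff_isCoprime (ha.map _), ha.natDegree_map, hb.natDegree_map,
    resultant_map_map] at h
  exact (isUnit_resultant_iff_isCoprime ha).1 (isUnit_of_map_unit _ _ h)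

theorem exists_eval_zero_eval_one_dvd {R k : Type*} [CommRing R] [Field k] (φ : R →+* k)
    [IsLocalHom φ] {a b : R[X]} (ha : a.Monic) (hb : b.Monic) {m n : ℕ}
    (ham : a.map φ = X ^ m) (hbn : b.map φ = (X - C 1) ^ n) :
    ∃ Q : R[X], Q.eval 0 = 0 ∧ Q.eval 1 = 1 ∧ a ∣ Q ∧ b ∣ 1 - Q := by
  have hX : IsCoprime (X : k[X]) (X - C 1) := ⟨1, -1, by simp⟩
  obtain ⟨u, w, h⟩ : IsCoprime (X * a) ((X - C 1) * b) := by
    refine isCoprime_of_isCoprime_map φ (monic_X.mul ha) ((monic_X_sub_C 1).mul hb) ?_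
    rw [Polynomial.map_mul, Polynomial.map_mul, Polynomial.map_sub, map_X, map_C, map_one, ham,
      hbn, ← pow_succ', ← pow_succ']
    exact hX.pow
  refine ⟨u * (X * a), by simp, ?_, ⟨u * X, by ring⟩, ⟨w * (X - C 1), ?_⟩⟩
  · rw [eq_sub_of_add_eq h]
    simp
  · rw [sub_eq_of_eq_add' h.symm]
    ring

theorem map_residue_prod_X_sub_C {V : Type*} [CommRing V] [IsLocalRing V] {s : Multiset V} {c : V}
    (hs : ∀ l ∈ s, l - c ∈ maximalIdeal V) :
    (s.map fun l => X - C l).prod.map (residue V) = (X - C (residue V c)) ^ s.card := by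
  rw [Polynomial.map_multiset_prod, Multiset.map_map, ← Multiset.prod_replicate,
    ← Multiset.map_const']
  refine congrArg Multiset.prod (Multiset.map_congr rfl fun l hl => ?_)
  have hlc : residue V l = residue V c := Ideal.Quotient.eq.2 (hs l hl)
  simp [hlc]

theorem exists_prod_X_sub_C_dvd_mul_one_sub {V : Type*} [CommRing V] [IsLocalRing V]
    {s : Multiset V} (hs : ∀ l ∈ s, l ∈ maximalIdeal V ∨ l - 1 ∈ maximalIdeal V) :
    ∃ Q : V[X], Q.eval 0 = 0 ∧ Q.eval 1 = 1 ∧ (s.map fun l => X - C l).prod ∣ Q * (1 - Q) := by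
  classical
  let s₀ := s.filter (· ∈ maximalIdeal V)
  let s₁ := s.filter (· ∉ maximalIdeal V)
  have h₀ : (s₀.map fun l => X - C l).prod.map (residue V) = X ^ s₀.card := by
    rw [map_residue_prod_X_sub_C (c := 0), map_zero, C_0, sub_zero]
    exact fun l hl => by rw [sub_zero]; exact (Multiset.mem_filter.1 hl).2
  have h₁ : (s₁.map fun l => X - C l).prod.map (residue V) = (X - C 1) ^ s₁.card := by
    rw [map_residue_prod_X_sub_C (c := 1), map_one]
    exact fun l hl => (hs l (Multiset.mem_filter.1 hl).1).resolve_left (Multiset.mem_filter.1 hl).2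
  obtain ⟨Q, hQ0, hQ1, ha, hb⟩ := exists_eval_zero_eval_one_dvd (residue V)
    (monic_multiset_prod_of_monic _ _ fun l _ => monic_X_sub_C l)
    (monic_multiset_prod_of_monic _ _ fun l _ => monic_X_sub_C l) h₀ h₁
  refine ⟨Q, hQ0, hQ1, ?_⟩
  rw [← Multiset.filter_add_not (· ∈ maximalIdeal V) s, Multiset.map_add, Multiset.prod_add]
  exact mul_dvd_mul ha hb

theorem exists_monic_map_eq_minpoly {O F B : Type*} [CommRing O] [IsDomain O]
    [IsIntegrallyClosed O] [Field F] [Algebra O F] [IsFractionRing O F] [Ring B] [Algebra F B]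
    [Algebra O B] [IsScalarTower O F B] {x : B} (hx : IsIntegral O x) :
    ∃ P : O[X], P.Monic ∧ P.map (algebraMap O F) = minpoly F x := by
  obtain ⟨p, hp, hpx⟩ := hx
  have hdvd : minpoly F x ∣ p.map (algebraMap O F) :=
    minpoly.dvd _ _ (by rwa [aeval_map_algebraMap])
  obtain ⟨P, hP⟩ := IsIntegrallyClosed.eq_map_mul_C_of_dvd F hp hdvd
  have hmonic : (minpoly F x).Monic := minpoly.monic ⟨_, hp.map _, by
    rw [← aeval_def, aeval_map_algebraMap]; exact hpx⟩
  rw [hmonic.leadingCoeff, C_1, mul_one] at hP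
  exact ⟨P, monic_of_injective (IsFractionRing.injective O F) (hP ▸ hmonic), hP⟩

end Polynomials

section EntrywiseMap

/-- The application of an algebra morphism to all entries of a family of matrices. -/
def matrixProdMap {ι : Type*} (d : ι → ℕ) {A K L : Type*} [CommRing A] [CommRing K] [CommRing L]
    [Algebra A K] [Algebra A L] (g : K →ₐ[A] L) : MatrixProd d K →ₐ[A] MatrixProd d L :=
  AlgHom.pi fun i => g.mapMatrix.comp (Pi.evalAlgHom A _ i)

variable {ι : Type*} {d : ι → ℕ} {A K L : Type*} [CommRing A] [CommRing K] [CommRing L]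
  [Algebra A K] [Algebra A L] (g : K →ₐ[A] L)

theorem matrixProdMap_apply (x : MatrixProd d K) (i : ι) :
    matrixProdMap d g x i = (x i).map g := rfl

theorem matrixProdMap_unitOn (S : Set ι) :
    matrixProdMap d g (unitOn d K S) = unitOn d L S := by
  ext i : 1
  rw [matrixProdMap_apply]
  by_cases hi : i ∈ S
  · rw [unitOn_apply_of_mem hi, unitOn_apply_of_mem hi,
      Matrix.map_one _ (map_zero g) (map_one g)]
  · rw [unitOn_apply_of_notMem hi, unitOn_apply_of_notMem hi, Matrix.map_zero _ (map_zero g)]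

variable (d K) in
/-- The basis of a product of matrix algebras that consists of the matrix units of the factors. -/
def matrixUnits [Finite ι] : Module.Basis (Σ i, Fin (d i) × Fin (d i)) K (MatrixProd d K) :=
  have := Fintype.ofFinite ι
  Pi.basis fun i => Matrix.stdBasis K (Fin (d i)) (Fin (d i))

theorem matrixUnits_apply [Finite ι] [DecidableEq ι] (i : ι) (j k : Fin (d i)) :
    matrixUnits d K ⟨i, j, k⟩ = Pi.single i (Matrix.single j k 1) := by
  let := Fintype.ofFinite ι
  rw [matrixUnits, Pi.basis_apply, Matrix.stdBasis_eq_single]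

theorem matrixProdMap_matrixUnits [Finite ι] (z : Σ i, Fin (d i) × Fin (d i)) :
    matrixProdMap d g (matrixUnits d K z) = matrixUnits d L z := by
  classical
  obtain ⟨i, j, k⟩ := z
  ext i' : 1
  rw [matrixProdMap_apply, matrixUnits_apply, matrixUnits_apply]
  rcases eq_or_ne i' i with rfl | hi
  · rw [Pi.single_eq_same, Pi.single_eq_same, Matrix.map_single, map_one]
  · rw [Pi.single_eq_of_ne hi, Pi.single_eq_of_ne hi, Matrix.map_zero _ (map_zero g)]

theorem span_image_matrixProdMap [Finite ι] {s : Set (MatrixProd d A)}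
    (hs : Submodule.span A s = ⊤) :
    Submodule.span K (matrixProdMap d (Algebra.ofId A K) '' s) = ⊤ := by
  rw [eq_top_iff, ← (matrixUnits d K).span_eq, Submodule.span_le]
  rintro _ ⟨z, rfl⟩
  rw [← matrixProdMap_matrixUnits (Algebra.ofId A K)]
  have hz : matrixProdMap d (Algebra.ofId A K) (matrixUnits d A z) ∈
      (Submodule.span A s).map (matrixProdMap d (Algebra.ofId A K)).toLinearMap :=
    Submodule.mem_map_of_mem (hs ▸ Submodule.mem_top)
  rw [Submodule.map_span] at hz
  exact Submodule.span_le_restrictScalars A K _ hz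

end EntrywiseMap

section CentralIdempotentMod

open Polynomial IsLocalRing

/-- Elements of an algebra that are idempotent and central modulo an ideal of the base ring. -/
structure IsCentralIdempotentMod {V Λ : Type*} [CommRing V] [Ring Λ] [Algebra V Λ] (I : Ideal V)
    (f : Λ) : Prop where
  mul_self_sub_mem : f * f - f ∈ I • (⊤ : Submodule V Λ)
  mul_sub_mul_mem (x : Λ) : f * x - x * f ∈ I • (⊤ : Submodule V Λ)

theorem isCentralIdempotentMod_tmul {O V Λ : Type*} [CommRing O] [CommRing V] [Algebra O V]
    [Ring Λ] [Algebra O Λ] {I : Ideal O} {f : Λ} {v : O} {c : V} (hc : v • c = 1)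
    (hf : f * f - v • f ∈ I • (⊤ : Submodule O Λ))
    (hcomm : ∀ x, f * x - x * f ∈ I • (⊤ : Submodule O Λ)) :
    IsCentralIdempotentMod (I.map (algebraMap O V)) (c ⊗ₜ[O] f) where
  mul_self_sub_mem := by
    have h : c ⊗ₜ f * c ⊗ₜ f - c ⊗ₜ[O] f = (c * c) ⊗ₜ[O] (f * f - v • f) := by
      rw [TensorProduct.tmul_sub, Algebra.TensorProduct.tmul_mul_tmul, ← TensorProduct.smul_tmul,
        ← mul_smul_comm, hc, mul_one]
    exact h ▸ tmul_mem_smul_top hf (c * c)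
  mul_sub_mul_mem x := by
    induction x using TensorProduct.induction_on with
    | zero => simp
    | add x y hx hy =>
      rw [mul_add, add_mul, add_sub_add_comm]
      exact add_mem hx hy
    | tmul x y =>
      rw [Algebra.TensorProduct.tmul_mul_tmul, Algebra.TensorProduct.tmul_mul_tmul, mul_comm x,
        ← TensorProduct.tmul_sub]
      exact tmul_mem_smul_top (hcomm y) (c * x)

namespace IsCentralIdempotentMod

variable {V Λ : Type*} [CommRing V] [Ring Λ] [Algebra V Λ] {I : Ideal V}

theorem mono {J : Ideal V} (hIJ : I ≤ J) {f : Λ} (hf : IsCentralIdempotentMod I f) :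
    IsCentralIdempotentMod J f where
  mul_self_sub_mem := Submodule.smul_mono_left hIJ hf.mul_self_sub_mem
  mul_sub_mul_mem x := Submodule.smul_mono_left hIJ (hf.mul_sub_mul_mem x)

theorem aeval_sub_mem {f : Λ} (hf : IsCentralIdempotentMod I f) {Q : V[X]} (h0 : Q.eval 0 = 0)
    (h1 : Q.eval 1 = 1) : aeval f Q - f ∈ I • (⊤ : Submodule V Λ) := by
  obtain ⟨G, rfl⟩ := exists_eq_X_add_mul h0 h1
  have : aeval f (X + (X ^ 2 - X) * G) - f = (f * f - f) * aeval f G := by simp [sq]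
  rw [this]
  exact mul_right_mem_smul_top hf.mul_self_sub_mem _

theorem mul_sub_mul_mem_of_sub_mem {e f : Λ} (hf : IsCentralIdempotentMod I f)
    (hef : e - f ∈ I • (⊤ : Submodule V Λ)) (x : Λ) :
    e * x - x * e ∈ I • (⊤ : Submodule V Λ) := by
  have h : e * x - x * e = (e - f) * x - x * (e - f) + (f * x - x * f) := by noncomm_ring
  rw [h]
  exact add_mem (sub_mem (mul_right_mem_smul_top hef x) (mul_left_mem_smul_top hef x))
    (hf.mul_sub_mul_mem x)

end IsCentralIdempotentMod

variable {V Λ : Type*} [CommRing V] [IsLocalRing V] [Ring Λ] [Algebra V Λ] [Module.Finite V Λ]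

theorem mul_mul_one_sub_eq_zero {e : Λ} (he : IsIdempotentElem e)
    (hc : ∀ x, e * x - x * e ∈ maximalIdeal V • (⊤ : Submodule V Λ)) (x : Λ) :
    e * x * (1 - e) = 0 := by
  let g : Λ →ₗ[V] Λ := LinearMap.mulRight V (1 - e) ∘ₗ LinearMap.mulLeft V e
  have hmem (x : Λ) : g x ∈ maximalIdeal V • (⊤ : Submodule V Λ) := by
    have : e * x * (1 - e) = e * (e * x - x * e) := by
      rw [mul_sub e, ← mul_assoc e e, he.eq]
      noncomm_ring
    change e * x * (1 - e) ∈ _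
    rw [this]
    exact mul_left_mem_smul_top (hc x) e
  have hidem (x : Λ) : g (g x) = g x := by
    change e * (e * x * (1 - e)) * (1 - e) = e * x * (1 - e)
    rw [← mul_assoc, ← mul_assoc, he.eq, mul_assoc _ (1 - e), he.one_sub.eq]
  have hbot : LinearMap.range g = ⊥ := by
    refine Submodule.eq_bot_of_le_smul_of_le_jacobson_bot (maximalIdeal V) _ ?_ ?_
      (jacobson_eq_maximalIdeal ⊥ bot_ne_top).ge
    · rw [LinearMap.range_eq_map]
      exact Module.Finite.fg_top.map _
    · rintro _ ⟨x, rfl⟩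
      rw [← hidem, LinearMap.range_eq_map, ← Submodule.map_smul'']
      exact Submodule.mem_map_of_mem (hmem x)
  exact (Submodule.mem_bot V).1 (hbot ▸ LinearMap.mem_range_self g x)

theorem commute_of_forall_mul_sub_mul_mem {e : Λ} (he : IsIdempotentElem e)
    (hc : ∀ x, e * x - x * e ∈ maximalIdeal V • (⊤ : Submodule V Λ)) (x : Λ) : Commute e x := by
  have h1 := mul_mul_one_sub_eq_zero he hc x
  have h2 := mul_mul_one_sub_eq_zero he.one_sub (fun x => by
    rw [show (1 - e) * x - x * (1 - e) = -(e * x - x * e) by noncomm_ring]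
    exact neg_mem (hc x)) x
  rw [mul_sub, mul_one, sub_eq_zero] at h1
  rw [sub_sub_cancel, sub_mul, sub_mul, one_mul, sub_eq_zero] at h2
  exact h1.trans h2.symm

/-- The roots of the equation of `f` reduce to `0` or to `1`, so that a polynomial in `f` is the
idempotent. -/
theorem IsCentralIdempotentMod.exists_isIdempotentElem_sub_mem [IsDomain V]
    (hsplits : ∀ p : V[X], p.Monic → p.Splits) {f : Λ}
    (hf : IsCentralIdempotentMod (maximalIdeal V) f) :
    ∃ e : Λ, IsIdempotentElem e ∧ (∀ x, Commute e x) ∧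
      e - f ∈ maximalIdeal V • (⊤ : Submodule V Λ) := by
  classical
  obtain ⟨p, hp, hpI, hpf⟩ :=
    exists_monic_isWeaklyEisensteinAt_aeval_eq_zero hf.mul_self_sub_mem
  let P : V[X] := p.comp (X * (X - C 1))
  have hP : P.Monic := hp.comp (monic_X.mul (monic_X_sub_C 1)) (by
    rw [monic_X.natDegree_mul (monic_X_sub_C 1), natDegree_X, natDegree_X_sub_C]
    omega)
  have hPf : aeval f P = 0 := by
    rw [aeval_comp, map_mul, map_sub, aeval_X, aeval_C, map_one, mul_sub, mul_one, hpf]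
  have hroot (l : V) (hl : l ∈ P.roots) : l ∈ maximalIdeal V ∨ l - 1 ∈ maximalIdeal V := by
    have hl0 : p.IsRoot (l * (l - 1)) := by
      simpa [P, eval_comp] using isRoot_of_mem_roots hl
    exact (maximalIdeal.isMaximal V).isPrime.mem_or_mem <|
      (maximalIdeal.isMaximal V).isPrime.mem_of_pow_mem _
        (hpI.pow_natDegree_le_of_root_of_monic_mem hl0 hp _ le_rfl)
  obtain ⟨Q, h0, h1, ⟨u, hu⟩⟩ := exists_prod_X_sub_C_dvd_mul_one_sub hroot
  rw [← (hsplits P hP).eq_prod_roots_of_monic hP] at hu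
  have hQ : aeval f Q * (1 - aeval f Q) = 0 := by
    simpa [hPf] using congrArg (aeval f) hu
  have he : IsIdempotentElem (aeval f Q) := by
    rwa [mul_sub, mul_one, sub_eq_zero, eq_comm] at hQ
  have hef := hf.aeval_sub_mem h0 h1
  exact ⟨aeval f Q, he,
    commute_of_forall_mul_sub_mul_mem he (hf.mul_sub_mul_mem_of_sub_mem hef), hef⟩

end CentralIdempotentMod

section Lifting

open Polynomial IsLocalRing

theorem exists_set_forall_mem_spectrum {V Λ K ι : Type*} [CommRing V] [IsDomain V] [IsLocalRing V]
    [Ring Λ] [Algebra V Λ] [Module.Finite V Λ] [Field K] [Algebra V K] [FaithfulSMul V K]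
    {d : ι → ℕ} (hsplits : ∀ p : V[X], p.Monic → p.Splits) {θ : Λ →ₐ[V] MatrixProd d K}
    (hspan : Submodule.span K (Set.range θ) = ⊤) {f : Λ}
    (hf : IsCentralIdempotentMod (maximalIdeal V) f) :
    ∃ S : Set ι, ∀ i, ∀ l : V, algebraMap V K l ∈ spectrum K (θ f i) →
      (i ∉ S → l ∈ maximalIdeal V) ∧ (i ∈ S → l - 1 ∈ maximalIdeal V) := by
  obtain ⟨e, he, hcomm, hef⟩ := hf.exists_isIdempotentElem_sub_mem hsplits
  obtain ⟨S, hS⟩ := exists_map_eq_unitOn (ρ := θ.toRingHom) hspan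
    (Subring.mem_center_iff.2 fun x => (hcomm x).symm) he
  have hdiff (i : ι) : ((Pi.evalAlgHom V _ i).comp θ) (f - e) = θ f i - unitOn d K S i := by
    rw [← hS]
    exact congrFun (map_sub θ f e) i
  have hmem : f - e ∈ maximalIdeal V • (⊤ : Submodule V Λ) := neg_sub e f ▸ neg_mem hef
  refine ⟨S, fun i l hl => ⟨fun hi => ?_, fun hi => ?_⟩⟩ <;>
    refine mem_of_algebraMap_mem_spectrum (K := K) ((Pi.evalAlgHom V _ i).comp θ) hmem ?_ <;>
    rw [hdiff]
  · rwa [unitOn_apply_of_notMem hi, sub_zero]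
  · have h := Set.sub_mem_sub hl (Set.mem_singleton 1)
    rw [spectrum.sub_singleton_eq, map_one] at h
    rwa [unitOn_apply_of_mem hi, map_sub, map_one]

theorem splits_of_isIntegrallyClosed {O F : Type*} [CommRing O] [IsIntegrallyClosed O] [Field F]
    [Algebra O F] [IsFractionRing O F] [IsAlgClosed F] (p : O[X]) (hp : p.Monic) : p.Splits := by
  refine (IsAlgClosed.splits (p.map (algebraMap O F))).of_splits_map_of_injective
    (IsFractionRing.injective O F) fun l hl => ?_
  exact IsIntegrallyClosed.isIntegral_iff.1 ⟨p, hp, by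
    rw [eval₂_eq_eval_map]; exact isRoot_of_mem_roots hl⟩

variable {O : Type*} [CommRing O] [IsLocalRing O] {F : Type*} [Field F] [Algebra O F]

theorem exists_map_residue_eq_X_sub_C_pow {V : Type*} [CommRing V] [IsLocalRing V] [Algebra O V]
    [IsLocalHom (algebraMap O V)] [IsDomain V] (hsplits : ∀ p : V[X], p.Monic → p.Splits)
    {K : Type*} [Field K] [Algebra V K] [Algebra F K] [Algebra O K] [IsScalarTower O V K]
    [IsScalarTower O F K] {n : ℕ} {x : Matrix (Fin n) (Fin n) F} {c : O}
    (hx : ∀ l : V, algebraMap V K l ∈ spectrum K (x.map (algebraMap F K)) →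
      l - algebraMap O V c ∈ maximalIdeal V) {P : O[X]} (hP : P.Monic)
    (hPx : P.map (algebraMap O F) = minpoly F x) :
    ∃ k, P.map (residue O) = (X - C (residue O c)) ^ k := by
  have hPV := (hsplits _ (hP.map (algebraMap O V))).eq_prod_roots_of_monic (hP.map _)
  refine ⟨(P.map (algebraMap O V)).roots.card,
    map_injective _ (ResidueField.map (algebraMap O V)).injective ?_⟩
  rw [Polynomial.map_map, ResidueField.map_comp_residue, ← Polynomial.map_map, Polynomial.map_pow,
    Polynomial.map_sub, map_X, map_C, ResidueField.map_residue]
  refine (congrArg (Polynomial.map (residue V)) hPV).trans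
    (map_residue_prod_X_sub_C fun l hl => hx l ?_)
  have hroot : (P.map (algebraMap O K)).IsRoot (algebraMap V K l) := by
    rw [IsScalarTower.algebraMap_eq O V K, ← Polynomial.map_map]
    exact (isRoot_of_mem_roots hl).map
  rw [Matrix.mem_spectrum_iff_isRoot_charpoly, Matrix.charpoly_map]
  refine hroot.dvd ?_
  rw [IsScalarTower.algebraMap_eq O F K, ← Polynomial.map_map, hPx]
  exact Polynomial.map_dvd _ (Matrix.minpoly_dvd_charpoly x)

variable {ι : Type*} [Finite ι] {d : ι → ℕ} {Λ : Type*} [Ring Λ] [Algebra O Λ]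
  [Module.Finite O Λ] {ρ : Λ →ₐ[O] MatrixProd d F}

/-- The eigenvalues are compared in a valuation ring that dominates `O` and in whose field of
fractions all of them lie. -/
theorem exists_set_minpoly_map_residue [IsDomain O] [IsIntegrallyClosed O] [IsFractionRing O F]
    (hspan : Submodule.span F (Set.range ρ) = ⊤) {f : Λ}
    (hf : IsCentralIdempotentMod (maximalIdeal O) f) :
    ∃ S : Set ι, ∀ i (P : O[X]), P.Monic → P.map (algebraMap O F) = minpoly F (ρ f i) →
      (i ∉ S → ∃ k, P.map (residue O) = X ^ k) ∧
        (i ∈ S → ∃ k, P.map (residue O) = (X - C 1) ^ k) := by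
  let K := AlgebraicClosure F
  obtain ⟨V, hV, hloc⟩ := IsLocalRing.exists_factor_valuationRing (algebraMap O K)
  let : Algebra O V := ((algebraMap O K).codRestrict V.toSubring hV).toAlgebra
  have : IsLocalHom (algebraMap O V) := hloc
  have : IsScalarTower O V K := IsScalarTower.of_algebraMap_eq fun _ => rfl
  let θ : V ⊗[O] Λ →ₐ[V] MatrixProd d K :=
    liftRep (((matrixProdMap d (Algebra.ofId F K)).restrictScalars O).comp ρ)
  have hθ (x : Λ) : θ (1 ⊗ₜ x) = matrixProdMap d (Algebra.ofId F K) (ρ x) :=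
    (liftRep_tmul _ _ _).trans (one_smul _ _)
  have hθspan : Submodule.span K (Set.range θ) = ⊤ := by
    rw [eq_top_iff, ← span_image_matrixProdMap (K := K) hspan]
    refine Submodule.span_mono ?_
    rintro _ ⟨_, ⟨x, rfl⟩, rfl⟩
    exact ⟨1 ⊗ₜ x, hθ x⟩
  have hsplits : ∀ p : V[X], p.Monic → p.Splits := splits_of_isIntegrallyClosed (F := K)
  have hone : IsCentralIdempotentMod ((maximalIdeal O).map (algebraMap O V)) ((1 : V) ⊗ₜ[O] f) :=
    isCentralIdempotentMod_tmul (v := 1) (one_smul O 1)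
      (by simpa only [one_smul] using hf.mul_self_sub_mem) hf.mul_sub_mul_mem
  obtain ⟨S, hS⟩ := exists_set_forall_mem_spectrum hsplits hθspan
    (hone.mono (((local_hom_TFAE (algebraMap O V)).out 0 2).1 hloc))
  simp only [hθ] at hS
  refine ⟨S, fun i P hP hPi => ⟨fun hi => ?_, fun hi => ?_⟩⟩
  · simpa only [map_zero, sub_zero] using exists_map_residue_eq_X_sub_C_pow hsplits (c := 0)
      (fun l hl => by simpa only [map_zero, sub_zero] using (hS i l hl).1 hi) hP hPi
  · simpa only [map_one] using exists_map_residue_eq_X_sub_C_pow hsplits (c := 1)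
      (fun l hl => by simpa only [map_one] using (hS i l hl).2 hi) hP hPi

theorem exists_unitOn_sub_mem_smul_top [IsDomain O] [IsIntegrallyClosed O] [IsFractionRing O F]
    (hspan : Submodule.span F (Set.range ρ) = ⊤) {f : Λ}
    (hf : IsCentralIdempotentMod (maximalIdeal O) f) :
    ∃ (S : Set ι) (e : Λ), ρ e = unitOn d F S ∧ e - f ∈ maximalIdeal O • (⊤ : Submodule O Λ) := by
  classical
  cases nonempty_fintype ι
  let val (i : ι) : Λ →ₐ[O] Matrix (Fin (d i)) (Fin (d i)) F := (Pi.evalAlgHom O _ i).comp ρ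
  obtain ⟨S, hS⟩ := exists_set_minpoly_map_residue hspan hf
  choose P hPm hP using fun i =>
    exists_monic_map_eq_minpoly (F := F) ((Algebra.IsIntegral.isIntegral (R := O) f).map (val i))
  choose! k hk using fun i => (hS i (P i) (hPm i) (hP i)).1
  choose! l hl using fun i => (hS i (P i) (hPm i) (hP i)).2
  obtain ⟨Q, h0, h1, ha, hb⟩ := exists_eval_zero_eval_one_dvd (residue O)
    (a := ∏ i with i ∉ S, P i) (b := ∏ i with i ∈ S, P i) (m := ∑ i with i ∉ S, k i)
    (n := ∑ i with i ∈ S, l i) (monic_prod_of_monic _ _ fun i _ => hPm i)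
    (monic_prod_of_monic _ _ fun i _ => hPm i)
    (by
      rw [Polynomial.map_prod, ← Finset.prod_pow_eq_pow_sum]
      exact Finset.prod_congr rfl fun i hi => hk i (Finset.mem_filter.1 hi).2)
    (by
      rw [Polynomial.map_prod, ← Finset.prod_pow_eq_pow_sum]
      exact Finset.prod_congr rfl fun i hi => hl i (Finset.mem_filter.1 hi).2)
  have hvanish (i : ι) {G : O[X]} (hG : P i ∣ G) : ρ (aeval f G) i = 0 := by
    obtain ⟨G, rfl⟩ := hG
    change val i (aeval f (P i * G)) = 0
    rw [← aeval_algHom_apply, map_mul, ← aeval_map_algebraMap F, hP, minpoly.aeval, zero_mul]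
  refine ⟨S, aeval f Q, funext fun i => ?_, hf.aeval_sub_mem h0 h1⟩
  by_cases hi : i ∈ S
  · have h := hvanish i ((Finset.dvd_prod_of_mem P (by simpa using hi)).trans hb)
    rw [map_sub, map_one, map_sub, map_one, Pi.sub_apply, sub_eq_zero] at h
    rw [unitOn_apply_of_mem hi, ← h, Pi.one_apply]
  · rw [unitOn_apply_of_notMem hi,
      hvanish i ((Finset.dvd_prod_of_mem P (by simpa using hi)).trans ha)]

end Lifting

/-! ### Laurent polynomial rings -/

section LaurentRings

variable {R : Type u} [CommRing R] {n : ℕ}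

theorem isIntegrallyClosed_laurent (R : Type u) [CommRing R] [IsDomain R] [IsIntegrallyClosed R]
    (n : ℕ) : IsIntegrallyClosed (Laurent R n) := by
  induction n with
  | zero => exact IsIntegrallyClosed.of_equiv (AddMonoidAlgebra.uniqueRingEquiv (Fin 0 → ℤ)).symm
  | succ n ih =>
    let split : (Fin (n + 1) → ℤ) ≃+ ℤ × (Fin n → ℤ) :=
      { (Fin.consEquiv fun _ => ℤ).symm with
        map_add' := fun _ _ => rfl }
    have : IsIntegrallyClosed (LaurentPolynomial (Laurent R n)) :=
      isIntegrallyClosed_of_isLocalization (R := Polynomial (Laurent R n)) _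
        (Submonoid.powers Polynomial.X) <| Submonoid.powers_le.2 <|
          mem_nonZeroDivisors_of_ne_zero Polynomial.X_ne_zero
    exact IsIntegrallyClosed.of_equiv
      ((AddMonoidAlgebra.domCongr R R split).toRingEquiv.trans
        AddMonoidAlgebra.curryRingEquiv).symm

theorem mem_extendedIdeal_iff {p : Ideal R} {x : Laurent R n} :
    x ∈ extendedIdeal p n ↔ ∀ g, x.coeff g ∈ p := by
  rw [← ker_mapRingHom_mk, RingHom.mem_ker, ← AddMonoidAlgebra.coeff_inj, DFunLike.ext_iff]
  simp [Ideal.Quotient.eq_zero_iff_mem]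

theorem single_mem_extendedIdeal {p : Ideal R} {r : R} (hr : r ∈ p) (g : Fin n → ℤ) :
    (AddMonoidAlgebra.single g r : Laurent R n) ∈ extendedIdeal p n := by
  rw [mem_extendedIdeal_iff]
  intro g'
  rw [AddMonoidAlgebra.coeff_single, Finsupp.single_apply]
  split_ifs
  exacts [hr, p.zero_mem]

theorem mapDomain_mem_extendedIdeal {p : Ideal R} {k : ℕ} (s : (Fin k → ℤ) → (Fin n → ℤ))
    {y : Laurent R k} (hy : y ∈ extendedIdeal p k) :
    (AddMonoidAlgebra.mapDomain s y : Laurent R n) ∈ extendedIdeal p n := by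
  rw [← AddMonoidAlgebra.sum_coeff_single y, AddMonoidAlgebra.mapDomain_sum, Finsupp.sum]
  refine sum_mem fun g _ => ?_
  rw [AddMonoidAlgebra.mapDomain_single]
  exact single_mem_extendedIdeal (mem_extendedIdeal_iff.1 hy g) _

theorem single_zsmul_sub_one_mem (a : Fin n → ℤ) (z : ℤ) :
    (AddMonoidAlgebra.single (z • a) 1 : Laurent R n) - 1 ∈ Ideal.span {monomial R a - 1} := by
  let π := Ideal.Quotient.mk (Ideal.span {monomial R a - 1})
  let θ := MonoidHom.toHomUnits <|
    (π : Laurent R n →* Laurent R n ⧸ Ideal.span {monomial R a - 1}).comp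
      (AddMonoidAlgebra.of R (Fin n → ℤ))
  have hθa : θ (Multiplicative.ofAdd a) = 1 :=
    Units.ext <| sub_eq_zero.1 <| Ideal.Quotient.eq_zero_iff_mem.2 (Ideal.subset_span rfl)
  have hθ : θ (Multiplicative.ofAdd (z • a)) = 1 := by rw [ofAdd_zsmul, map_zpow, hθa, one_zpow]
  exact Ideal.Quotient.eq.1 (congrArg Units.val hθ)

section Contraction

variable {k : ℕ} {a : Fin n → ℤ} {f : (Fin n → ℤ) →+ (Fin k → ℤ)}

theorem single_sub_single_mem (hf : f.ker = AddSubgroup.zmultiples a) {g g' : Fin n → ℤ}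
    (h : f g = f g') (r : R) :
    (AddMonoidAlgebra.single g r : Laurent R n) - AddMonoidAlgebra.single g' r ∈
      Ideal.span {monomial R a - 1} := by
  obtain ⟨z, hz⟩ : ∃ z : ℤ, z • a = g - g' := by
    rw [← AddSubgroup.mem_zmultiples_iff, ← hf, AddMonoidHom.mem_ker, map_sub, h, sub_self]
  have : (AddMonoidAlgebra.single g r : Laurent R n) - AddMonoidAlgebra.single g' r =
      AddMonoidAlgebra.single g' r * (AddMonoidAlgebra.single (z • a) 1 - 1) := by
    rw [mul_sub, mul_one, AddMonoidAlgebra.single_mul_single, mul_one, hz, add_sub_cancel]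
  rw [this]
  exact Ideal.mul_mem_left _ _ (single_zsmul_sub_one_mem a z)

theorem sub_mapDomain_invFun_mem (hf : f.ker = AddSubgroup.zmultiples a) (x : Laurent R n) :
    x - AddMonoidAlgebra.mapDomain (Function.invFun f) (AddMonoidAlgebra.mapDomain f x) ∈
      Ideal.span {monomial R a - 1} := by
  induction x using AddMonoidAlgebra.induction_linear with
  | zero => simp
  | add x y hx hy =>
    rw [AddMonoidAlgebra.mapDomain_add, AddMonoidAlgebra.mapDomain_add, add_sub_add_comm]
    exact Ideal.add_mem _ hx hy
  | single g r =>
    rw [AddMonoidAlgebra.mapDomain_single, AddMonoidAlgebra.mapDomain_single]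
    exact single_sub_single_mem hf (Function.invFun_eq ⟨g, rfl⟩).symm r

theorem mem_monomialIdeal_iff {p : Ideal R} (hf : f.ker = AddSubgroup.zmultiples a)
    {x : Laurent R n} :
    x ∈ monomialIdeal p a ↔ AddMonoidAlgebra.mapDomainAlgHom R R f x ∈ extendedIdeal p k := by
  constructor
  · have hfa : f a = 0 := by
      rw [← AddMonoidHom.mem_ker, hf]
      exact AddSubgroup.mem_zmultiples a
    suffices monomialIdeal p a ≤
        (extendedIdeal p k).comap (AddMonoidAlgebra.mapDomainAlgHom R R f) from fun hx => this hx
    refine sup_le ?_ (Ideal.map_le_iff_le_comap.2 fun r hr => ?_)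
    · rw [Ideal.span_singleton_le_iff_mem, Ideal.mem_comap]
      have : AddMonoidAlgebra.mapDomainAlgHom R R f (monomial R a) = 1 := by
        simp [monomial, hfa, AddMonoidAlgebra.one_def]
      rw [map_sub, this, map_one, sub_self]
      exact zero_mem _
    · rw [Ideal.mem_comap, Ideal.mem_comap, AlgHom.commutes]
      exact Ideal.mem_map_of_mem _ hr
  · intro hx
    rw [← sub_add_cancel x
      (AddMonoidAlgebra.mapDomain (Function.invFun f) (AddMonoidAlgebra.mapDomain f x))]
    exact Ideal.add_mem _ (Ideal.mem_sup_left (sub_mapDomain_invFun_mem hf x))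
      (Ideal.mem_sup_right (mapDomain_mem_extendedIdeal _ hx))

end Contraction

theorem exists_ker_eq_zmultiples {a : Fin n → ℤ} (ha : IsPrimitiveExponent a) :
    ∃ f : (Fin n → ℤ) →+ (Fin n → ℤ), f.ker = AddSubgroup.zmultiples a := by
  obtain ⟨c, hc⟩ := Finset.gcd_eq_sum_mul Finset.univ a
  rw [ha] at hc
  let u : (Fin n → ℤ) →+ ℤ :=
    { toFun := fun g => ∑ i, g i * c i
      map_zero' := by simp
      map_add' := fun g g' => by simp [add_mul, Finset.sum_add_distrib] }
  have hu : u a = 1 := hc.symm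
  refine ⟨AddMonoidHom.id _ - (zmultiplesHom _ a).comp u, ?_⟩
  ext g
  rw [AddMonoidHom.mem_ker, AddSubgroup.mem_zmultiples_iff]
  constructor
  · intro h
    exact ⟨u g, (sub_eq_zero.1 h).symm⟩
  · rintro ⟨k, rfl⟩
    change k • a - u (k • a) • a = 0
    rw [map_zsmul, hu, smul_eq_mul, mul_one, sub_self]

section Morphism

variable {m : ℕ} {a : Fin (m + 1) → ℤ} {φ : Laurent R (m + 1) →ₐ[R] Laurent R m}

theorem IsAssociatedMorphism.surjective (hφ : IsAssociatedMorphism a φ) :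
    Function.Surjective φ := by
  obtain ⟨f, hf, -, rfl⟩ := hφ
  intro x
  obtain ⟨y, hy⟩ := Finsupp.mapDomain_surjective hf x.coeff
  exact ⟨.ofCoeff y, AddMonoidAlgebra.coeff_injective hy⟩

theorem IsAssociatedMorphism.mem_extendedIdeal_iff (hφ : IsAssociatedMorphism a φ) (p : Ideal R)
    (x : Laurent R (m + 1)) : φ x ∈ extendedIdeal p m ↔ x ∈ monomialIdeal p a := by
  obtain ⟨f, -, hf, rfl⟩ := hφ
  exact (mem_monomialIdeal_iff hf).symm

theorem IsAssociatedMorphism.eq_zero_iff (hφ : IsAssociatedMorphism a φ)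
    (x : Laurent R (m + 1)) : φ x = 0 ↔ x ∈ monomialIdeal (⊥ : Ideal R) a := by
  rw [← hφ.mem_extendedIdeal_iff, extendedIdeal, Ideal.map_bot, Ideal.mem_bot]

end Morphism

section GaussLemma

theorem exists_notMem_forall_gt_mem {Q G : Type*} [CommRing Q] [LinearOrder G] {I : Ideal Q}
    {u : G →₀ Q} (hu : ∃ g, u g ∉ I) : ∃ a, u a ∉ I ∧ ∀ b, a < b → u b ∈ I := by
  have hfin : {g | u g ∉ I}.Finite := u.support.finite_toSet.subset fun g hg =>
    Finsupp.mem_support_iff.2 fun h0 => hg (h0 ▸ I.zero_mem)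
  obtain ⟨a, ha⟩ := hfin.exists_maximal hu
  exact ⟨a, ha.prop, fun b hab => not_not.1 fun hb => ha.not_gt hb hab⟩

/-- Modulo `𝔪` the factor `v` has a highest exponent; comparing coefficients downwards shows that
the coefficients of `f` lie in `N + 𝔪 J`, where `J` is the ideal they generate, and Nakayama's lemma
applies. -/
theorem coeff_mem_of_forall_coeff_mul_mem {Q G : Type*} [CommRing Q] [IsLocalRing Q]
    [AddCommGroup G] [LinearOrder G] [IsOrderedAddMonoid G] {N : Ideal Q}
    {f v : AddMonoidAlgebra Q G} (hv : ∃ g, v.coeff g ∉ IsLocalRing.maximalIdeal Q)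
    (hfv : ∀ g, (f * v).coeff g ∈ N) (g : G) : f.coeff g ∈ N := by
  classical
  let 𝔪 := IsLocalRing.maximalIdeal Q
  let J : Ideal Q := Ideal.span (f.coeff.support.image f.coeff : Finset Q)
  have hJ : ∀ h ∈ f.coeff.support, f.coeff h ∈ J := fun h hh =>
    Ideal.subset_span (Finset.mem_coe.2 (Finset.mem_image_of_mem _ hh))
  obtain ⟨a, ha, ha_max⟩ := exists_notMem_forall_gt_mem hv
  suffices hcoeff : ∀ h, f.coeff h ∈ N ⊔ 𝔪 • J by
    have hJN : J ≤ N := by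
      refine Submodule.le_of_le_smul_of_le_jacobson_bot ⟨_, rfl⟩
        (IsLocalRing.maximalIdeal_le_jacobson _) (Ideal.span_le.2 fun x hx => ?_)
      obtain ⟨h, -, rfl⟩ := Finset.mem_image.1 (Finset.mem_coe.1 hx)
      exact hcoeff h
    by_cases hg : g ∈ f.coeff.support
    · exact hJN (hJ g hg)
    · exact Finsupp.notMem_support_iff.1 hg ▸ N.zero_mem
  by_contra! hbad
  obtain ⟨h, hh, hh_max⟩ := exists_notMem_forall_gt_mem hbad
  have hsupp : h ∈ f.coeff.support :=
    Finsupp.mem_support_iff.2 fun h0 => hh (h0 ▸ zero_mem _)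
  have hrest : ∀ k ∈ f.coeff.support.erase h,
      f.coeff k * v.coeff (-k + (h + a)) ∈ N ⊔ 𝔪 • J := by
    intro k hk
    obtain ⟨hkh, hk⟩ := Finset.mem_erase.1 hk
    rcases lt_or_gt_of_ne hkh with hlt | hgt
    · refine Ideal.mem_sup_right (mul_comm (f.coeff k) _ ▸
        Submodule.smul_mem_smul (ha_max _ ?_) (hJ k hk))
      rwa [← add_assoc, lt_add_iff_pos_left, neg_add_eq_sub, sub_pos]
    · exact Ideal.mul_mem_right _ _ (hh_max k hgt)
  have htop : f.coeff h * v.coeff a ∈ N ⊔ 𝔪 • J := by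
    have hsum := Ideal.mem_sup_left (T := 𝔪 • J) (hfv (h + a))
    rw [AddMonoidAlgebra.coeff_mul_apply_left, Finsupp.sum, ← Finset.add_sum_erase _ _ hsupp,
      neg_add_cancel_left] at hsum
    exact (Ideal.add_mem_iff_left _ (sum_mem hrest)).1 hsum
  exact hh ((Ideal.mul_unit_mem_iff_mem _ (IsLocalRing.notMem_maximalIdeal.1 ha)).1 htop)

theorem exists_notMem_mul_mem_extendedIdeal {p : Ideal R} (hp : p.IsPrime) {N : Ideal R}
    {f v : Laurent R n} (hv : v ∉ extendedIdeal p n) (hfv : f * v ∈ extendedIdeal N n) :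
    ∃ c ∉ p, algebraMap R (Laurent R n) c * f ∈ extendedIdeal N n := by
  let ρ := AddMonoidAlgebra.mapRingHom (Fin n → ℤ) (algebraMap R (Localization.AtPrime p))
  have hρ : ∀ (x : Laurent R n) g, (ρ x).coeff g = algebraMap R _ (x.coeff g) := by simp [ρ]
  have hv' : ∃ g, (ρ v).coeff g ∉ IsLocalRing.maximalIdeal (Localization.AtPrime p) := by
    simp only [hρ, IsLocalization.AtPrime.to_map_mem_maximal_iff _ p]
    rw [mem_extendedIdeal_iff] at hv
    exact not_forall.1 hv
  have hfv' : ∀ g, (ρ f * ρ v).coeff g ∈ N.map (algebraMap R (Localization.AtPrime p)) := by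
    intro g
    rw [← map_mul, hρ]
    exact Ideal.mem_map_of_mem _ (mem_extendedIdeal_iff.1 hfv g)
  have hcoeff : ∀ g, ∃ c ∈ p.primeCompl, c * f.coeff g ∈ N := by
    intro g
    rw [← IsLocalization.algebraMap_mem_map_algebraMap_iff p.primeCompl (Localization.AtPrime p),
      ← hρ]
    exact @coeff_mem_of_forall_coeff_mul_mem _ (Fin n → ℤ) _ _ _
      (inferInstanceAs (LinearOrder (Lex (Fin n → ℤ))))
      (inferInstanceAs (IsOrderedAddMonoid (Lex (Fin n → ℤ)))) _ _ _ hv' hfv' g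
  choose c hc hcf using hcoeff
  refine ⟨∏ g ∈ f.coeff.support, c g, prod_mem (S := p.primeCompl) fun g _ => hc g, ?_⟩
  rw [mem_extendedIdeal_iff]
  intro g
  rw [← Algebra.smul_def, AddMonoidAlgebra.coeff_smul, Finsupp.smul_apply, smul_eq_mul]
  by_cases hg : g ∈ f.coeff.support
  · rw [← Finset.prod_erase_mul _ _ hg, mul_assoc]
    exact N.mul_mem_left _ (hcf g)
  · rw [Finsupp.notMem_support_iff.1 hg, mul_zero]
    exact N.zero_mem

end GaussLemma

end LaurentRings

/-! ### Essential factorizations -/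

section Factorizations

open Polynomial

section Monomials

variable (R : Type u) [CommRing R] {n : ℕ}

theorem monomial_zero : monomial R (0 : Fin n → ℤ) = 1 :=
  rfl

theorem monomial_add (a b : Fin n → ℤ) : monomial R (a + b) = monomial R a * monomial R b := by
  rw [monomial, monomial, monomial, AddMonoidAlgebra.single_mul_single, mul_one]

theorem monomial_nsmul (k : ℕ) (a : Fin n → ℤ) : monomial R (k • a) = monomial R a ^ k := by
  rw [monomial, monomial, AddMonoidAlgebra.single_pow, one_pow]

theorem monomial_sum {ι : Type*} (s : Finset ι) (a : ι → Fin n → ℤ) :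
    monomial R (∑ i ∈ s, a i) = ∏ i ∈ s, monomial R (a i) := by
  classical
  induction s using Finset.induction_on with
  | empty => exact monomial_zero R
  | insert i s hi ih => rw [Finset.sum_insert hi, Finset.prod_insert hi, monomial_add, ih]

theorem isUnit_monomial (a : Fin n → ℤ) : IsUnit (monomial R a) :=
  IsUnit.of_mul_eq_one (monomial R (-a)) <| by rw [← monomial_add, add_neg_cancel, monomial_zero]

variable {R}

theorem mapDomainAlgHom_monomial {k : ℕ} (f : (Fin n → ℤ) →+ (Fin k → ℤ)) (b : Fin n → ℤ) :
    AddMonoidAlgebra.mapDomainAlgHom R R f (monomial R b) = monomial R (f b) := by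
  simp [monomial]

theorem coeff_aeval_monomial {b : Fin n → ℤ} (hb : b ≠ 0) (Ψ : R[X]) (k : ℕ) :
    (aeval (monomial R b) Ψ).coeff (k • b) = Ψ.coeff k := by
  have hinj : Function.Injective fun i : ℕ => i • b := fun i j hij => by
    obtain ⟨l, hl⟩ := Function.ne_iff.1 hb
    have hij := congrFun hij l
    simp only [Pi.smul_apply, nsmul_eq_mul] at hij
    exact_mod_cast mul_right_cancel₀ hl hij
  induction Ψ using Polynomial.induction_on' with
  | add Φ Ψ hΦ hΨ => simp only [map_add, AddMonoidAlgebra.coeff_add, Finsupp.add_apply, hΦ, hΨ,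
      coeff_add]
  | monomial i r =>
    rw [aeval_monomial, ← monomial_nsmul, ← Algebra.smul_def, AddMonoidAlgebra.coeff_smul,
      EssentialAlgebra.monomial, AddMonoidAlgebra.coeff_single, Finsupp.smul_apply,
      Finsupp.single_apply, coeff_monomial]
    simp only [hinj.eq_iff, smul_eq_mul, mul_ite, mul_one, mul_zero]

end Monomials

section Primitive

variable {n : ℕ} {a b : Fin n → ℤ}

theorem eq_or_eq_neg_of_mem_zmultiples (hb : IsPrimitiveExponent b)
    (h : b ∈ AddSubgroup.zmultiples a) : b = a ∨ b = -a := by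
  obtain ⟨k, rfl⟩ := h
  have hk : k ∣ 1 := by
    rw [← show Finset.univ.gcd (k • a) = 1 from hb]
    exact Finset.dvd_gcd fun i _ => ⟨a i, rfl⟩
  rcases Int.isUnit_iff.1 (isUnit_of_dvd_one hk) with rfl | rfl
  · left; simp
  · right; simp

theorem IsPrimitiveExponent.neg (ha : IsPrimitiveExponent a) : IsPrimitiveExponent (-a) := by
  rw [IsPrimitiveExponent, ← Finset.normalize_gcd, normalize_eq_one]
  refine isUnit_of_dvd_one ?_
  rw [← show Finset.univ.gcd a = 1 from ha]
  exact Finset.dvd_gcd fun i hi => (dvd_neg (b := a i)).1 (Finset.gcd_dvd (f := -a) hi)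

variable {R : Type u} [CommRing R] {p : Ideal R}

theorem aeval_monomial_notMem_monomialIdeal (hp : p.IsPrime) (ha : IsPrimitiveExponent a)
    (hb : b ∉ AddSubgroup.zmultiples a) {Ψ : R[X]} (hΨ : Ψ.Monic) :
    aeval (monomial R b) Ψ ∉ monomialIdeal p a := by
  obtain ⟨f, hf⟩ := exists_ker_eq_zmultiples ha
  have hfb : f b ≠ 0 := by rwa [← hf, AddMonoidHom.mem_ker] at hb
  rw [mem_monomialIdeal_iff hf, ← aeval_algHom_apply, mapDomainAlgHom_monomial,
    mem_extendedIdeal_iff]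
  intro h
  have hlead := h (Ψ.natDegree • f b)
  rw [coeff_aeval_monomial hfb, hΨ.coeff_natDegree] at hlead
  exact hp.one_notMem hlead

theorem aeval_monomial_mem_monomialIdeal_iff (ha : IsPrimitiveExponent a)
    (hb : b ∈ AddSubgroup.zmultiples a) (Ψ : R[X]) :
    aeval (monomial R b) Ψ ∈ monomialIdeal p a ↔ Ψ.eval 1 ∈ p := by
  obtain ⟨f, hf⟩ := exists_ker_eq_zmultiples ha
  have hfb : f b = 0 := by rwa [← hf, AddMonoidHom.mem_ker] at hb
  rw [mem_monomialIdeal_iff hf, ← aeval_algHom_apply, mapDomainAlgHom_monomial, hfb,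
    monomial_zero, ← map_one (algebraMap R (Laurent R n)),
    aeval_algebraMap_apply_eq_algebraMap_eval]
  refine ⟨fun h => ?_, Ideal.mem_map_of_mem _⟩
  simpa using mem_extendedIdeal_iff.1 h 0

end Primitive

section InvRoots

theorem reverse_eq_mirror {R : Type*} [Semiring R] {Ψ : R[X]} (h0 : Ψ.coeff 0 ≠ 0) :
    Ψ.reverse = Ψ.mirror := by
  rw [mirror, natTrailingDegree_eq_zero.2 (Or.inr h0), pow_zero, mul_one]

theorem irreducible_mirror_iff {R : Type*} [CommRing R] [IsDomain R] {Ψ : R[X]} :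
    Irreducible Ψ.mirror ↔ Irreducible Ψ :=
  let mirrorEquiv : R[X] ≃* R[X] :=
    { toFun := mirror
      invFun := mirror
      left_inv := mirror_mirror
      right_inv := mirror_mirror
      map_mul' := fun f g => mirror_mul_of_domain f g }
  MulEquiv.irreducible_iff mirrorEquiv

theorem eval_one_reverse {R : Type*} [Semiring R] (Ψ : R[X]) :
    Ψ.reverse.eval 1 = Ψ.eval 1 := by
  simpa [mirror] using mirror_eval_one Ψ

theorem map_reverse_of_monic {R S : Type*} [CommRing R] [CommRing S] [Nontrivial S] {Ψ : R[X]}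
    (hΨ : Ψ.Monic) (i : R →+* S) : Ψ.reverse.map i = (Ψ.map i).reverse := by
  ext k
  rw [coeff_map, coeff_reverse, coeff_reverse, coeff_map, hΨ.natDegree_map]

variable {R : Type u} [CommRing R]

/-- The polynomial `c⁻¹ x ^ deg Ψ Ψ(x⁻¹)`. When `c` is the constant term of the monic polynomial
`Ψ`, it is monic and its roots are the inverses of the roots of `Ψ`. -/
def invRootsPoly (Ψ : R[X]) (c : Rˣ) : R[X] := C (↑c⁻¹ : R) * Ψ.reverse

variable {Ψ : R[X]} {c : Rˣ}

theorem coeff_zero_invRootsPoly (hΨ : Ψ.Monic) : (invRootsPoly Ψ c).coeff 0 = ↑c⁻¹ := by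
  rw [invRootsPoly, coeff_C_mul, coeff_zero_reverse, hΨ, mul_one]

theorem eval_one_invRootsPoly : (invRootsPoly Ψ c).eval 1 = ↑c⁻¹ * Ψ.eval 1 := by
  rw [invRootsPoly, eval_mul, eval_C, eval_one_reverse]

theorem aeval_invRootsPoly {n : ℕ} (b : Fin n → ℤ) :
    aeval (monomial R b) Ψ = algebraMap R (Laurent R n) c * monomial R (Ψ.natDegree • b) *
      aeval (monomial R (-b)) (invRootsPoly Ψ c) := by
  let _ : Invertible (monomial R b) :=
    { invOf := monomial R (-b)
      invOf_mul_self := by rw [← monomial_add, neg_add_cancel, monomial_zero]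
      mul_invOf_self := by rw [← monomial_add, add_neg_cancel, monomial_zero] }
  have hrev : aeval (monomial R (-b)) Ψ.reverse * monomial R (Ψ.natDegree • b) =
      aeval (monomial R b) Ψ := by
    rw [monomial_nsmul]
    exact eval₂_reverse_mul_pow (algebraMap R (Laurent R n)) (monomial R b) Ψ
  have hc : algebraMap R (Laurent R n) c * algebraMap R (Laurent R n) ↑c⁻¹ = 1 := by
    rw [← map_mul, Units.mul_inv, map_one]
  rw [← hrev, invRootsPoly, map_mul, aeval_C]
  linear_combination -(aeval (monomial R (-b)) Ψ.reverse * monomial R (Ψ.natDegree • b)) * hc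

theorem natDegree_invRootsPoly [IsDomain R] (hc : Ψ.coeff 0 = c) :
    (invRootsPoly Ψ c).natDegree = Ψ.natDegree := by
  rw [invRootsPoly, natDegree_C_mul (Units.ne_zero _),
    reverse_eq_mirror (hc ▸ Units.ne_zero _), mirror_natDegree]

theorem monic_invRootsPoly [IsDomain R] (hc : Ψ.coeff 0 = c) : (invRootsPoly Ψ c).Monic := by
  have htrailing : Ψ.natTrailingDegree = 0 :=
    natTrailingDegree_eq_zero.2 (Or.inr (hc ▸ Units.ne_zero _))
  rw [Monic, invRootsPoly, leadingCoeff_mul, leadingCoeff_C, reverse_leadingCoeff, trailingCoeff,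
    htrailing, hc, Units.inv_mul]

theorem irreducible_map_invRootsPoly {K : Type*} [Field K] {i : R →+* K} (hΨ : Ψ.Monic)
    (hc : Ψ.coeff 0 = c) (hirr : Irreducible (Ψ.map i)) :
    Irreducible ((invRootsPoly Ψ c).map i) := by
  have h0 : (Ψ.map i).coeff 0 ≠ 0 := by
    rw [coeff_map, hc]
    exact (c.isUnit.map i).ne_zero
  rw [invRootsPoly, Polynomial.map_mul, map_C, map_reverse_of_monic hΨ, reverse_eq_mirror h0,
    irreducible_isUnit_mul (isUnit_C.2 ((Units.isUnit c⁻¹).map i))]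
  exact irreducible_mirror_iff.2 hirr

end InvRoots

namespace EssentialFactorization

variable {R : Type u} [CommRing R] [IsDomain R] {n : ℕ} (d : EssentialFactorization R n)

/-- The product `N ∏ᵢ Ψᵢ(Mᵢ)^{nᵢ}` of the factors other than the coefficient `ξ`. -/
def cofactor : Laurent R n :=
  monomial R d.N * ∏ i, (aeval (monomial R (d.M i)) (d.Ψ i)) ^ d.mult i

theorem value_eq : d.value = algebraMap R (Laurent R n) d.ξ * d.cofactor :=
  mul_assoc _ _ _

theorem cofactor_notMem {p : Ideal R} (hp : p.IsPrime) {a : Fin n → ℤ}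
    (ha : IsPrimitiveExponent a) (h : ∀ i, d.M i = a ∨ d.M i = -a → (d.Ψ i).eval 1 ∉ p) :
    d.cofactor ∉ monomialIdeal p a := by
  have hq := monomialIdeal_isPrime p hp a ha
  intro hmem
  rcases hq.mem_or_mem hmem with hN | hprod
  · exact hq.ne_top (Ideal.eq_top_of_isUnit_mem _ hN (isUnit_monomial R _))
  obtain ⟨i, -, hpow⟩ := hq.prod_mem_iff.1 hprod
  have hfactor := hq.mem_of_pow_mem _ hpow
  by_cases hi : d.M i ∈ AddSubgroup.zmultiples a
  · rw [aeval_monomial_mem_monomialIdeal_iff ha hi] at hfactor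
    exact h i (eq_or_eq_neg_of_mem_zmultiples (d.M_primitive i) hi) hfactor
  · exact aeval_monomial_notMem_monomialIdeal hp ha hi (d.Ψ_monic i) hfactor

theorem eval_one_ne_zero (i : Fin d.card) : (d.Ψ i).eval 1 ≠ 0 := by
  intro h
  obtain ⟨u, w, huw⟩ := d.Ψ_coprime_X_sub_one i
  have := congrArg (eval 1) huw
  simp [eval_map, eval₂_at_one, h] at this

/-- The factorization of `d.value` in which every monomial `Mᵢ` is replaced by its inverse and
`Ψᵢ` by the polynomial with inverse roots. -/
def invert : EssentialFactorization R n where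
  ξ := d.ξ * ∏ i, ((d.Ψ_const i).unit : R) ^ d.mult i
  N := d.N + ∑ i, d.mult i • (d.Ψ i).natDegree • d.M i
  N_degree := by
    simp only [Pi.add_apply, Finset.sum_apply, Pi.smul_apply, Finset.sum_add_distrib, d.N_degree]
    rw [Finset.sum_comm]
    simp only [← Finset.smul_sum, d.M_degree, smul_zero, Finset.sum_const_zero, add_zero]
  card := d.card
  Ψ i := invRootsPoly (d.Ψ i) (d.Ψ_const i).unit
  Ψ_monic _ := monic_invRootsPoly rfl
  Ψ_degree i := (d.Ψ_degree i).trans_eq (natDegree_invRootsPoly rfl).symm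
  Ψ_irreducible i := irreducible_map_invRootsPoly (d.Ψ_monic i) rfl (d.Ψ_irreducible i)
  Ψ_coprime_X i := by
    rw [isCoprime_comm, irreducible_X.coprime_iff_not_dvd, X_dvd_iff, coeff_map,
      coeff_zero_invRootsPoly (d.Ψ_monic i)]
    exact ((Units.isUnit _).map (algebraMap R (FractionRing R))).ne_zero
  Ψ_coprime_X_sub_one i := by
    rw [isCoprime_comm, ← C_1, (irreducible_X_sub_C (1 : FractionRing R)).coprime_iff_not_dvd,
      dvd_iff_isRoot, IsRoot, eval_map, eval₂_at_one, eval_one_invRootsPoly,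
      FaithfulSMul.algebraMap_eq_zero_iff]
    exact mul_ne_zero (Units.ne_zero _) (d.eval_one_ne_zero i)
  Ψ_const i := (coeff_zero_invRootsPoly (d.Ψ_monic i)).symm ▸ Units.isUnit _
  M i := -d.M i
  M_degree i := by simp only [Pi.neg_apply, Finset.sum_neg_distrib, d.M_degree, neg_zero]
  M_primitive i := (d.M_primitive i).neg
  mult := d.mult
  mult_pos := d.mult_pos

theorem value_invert : d.invert.value = d.value := by
  have hfactor : ∀ i, aeval (monomial R (d.M i)) (d.Ψ i) ^ d.mult i =
      algebraMap R (Laurent R n) ((d.Ψ_const i).unit : R) ^ d.mult i *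
        monomial R (d.mult i • (d.Ψ i).natDegree • d.M i) *
          aeval (monomial R (d.invert.M i)) (d.invert.Ψ i) ^ d.mult i := by
    intro i
    rw [aeval_invRootsPoly (c := (d.Ψ_const i).unit) (d.M i), mul_pow, mul_pow,
      monomial_nsmul R (d.mult i)]
    rfl
  calc d.invert.value
      = algebraMap R (Laurent R n) (d.ξ * ∏ i, ((d.Ψ_const i).unit : R) ^ d.mult i) *
          monomial R (d.N + ∑ i, d.mult i • (d.Ψ i).natDegree • d.M i) *
            ∏ i : Fin d.card, aeval (monomial R (d.invert.M i)) (d.invert.Ψ i) ^ d.mult i := rfl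
    _ = d.value := by
      rw [value, Finset.prod_congr rfl fun i _ => hfactor i, Finset.prod_mul_distrib,
        Finset.prod_mul_distrib, ← monomial_sum, monomial_add, map_mul, map_prod]
      simp only [map_pow]
      ring

end EssentialFactorization

theorem eval_one_notMem_of_not_isEssentialMonomial {R : Type u} [CommRing R] [IsDomain R] {n : ℕ}
    {H : Type v} [Ring H] [Algebra (Laurent R n) H] {t : H →ₗ[Laurent R n] Laurent R n}
    {p : Ideal R} {a : Fin n → ℤ} {χ : IrrGeneric (Laurent R n) H}
    (hχ : ¬ IsEssentialMonomial t p a χ) (d : EssentialFactorization R n)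
    (hd : IsSchurElement t χ (algebraMap (Laurent R n) (FractionRing (Laurent R n)) d.value))
    (i : Fin d.card) (hi : d.M i = a ∨ d.M i = -a) : (d.Ψ i).eval 1 ∉ p := by
  intro hmem
  rcases hi with hi | hi
  · exact hχ ⟨d, hd, i, hi, hmem⟩
  · refine hχ ⟨d.invert, d.value_invert.symm ▸ hd, i, neg_eq_iff_eq_neg.2 hi, ?_⟩
    exact (eval_one_invRootsPoly (Ψ := d.Ψ i)).symm ▸ p.mul_mem_left _ hmem

end Factorizations

/-! ### Symmetrizing forms and Schur elements -/

section Schur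

theorem isIntegral_trace_of_isIntegral {O F : Type*} [CommRing O] [Field F] [Algebra O F]
    {m : Type*} [Fintype m] [DecidableEq m] {X : Matrix m m F} (hX : IsIntegral O X) :
    IsIntegral O X.trace := by
  cases isEmpty_or_nonempty m
  · rw [Matrix.trace_eq_zero_of_isEmpty]
    exact isIntegral_zero
  let K := AlgebraicClosure F
  let Y : Matrix m m K := (IsScalarTower.toAlgHom O F K).mapMatrix X
  obtain ⟨p, hp, hpY⟩ := hX.map (IsScalarTower.toAlgHom O F K).mapMatrix
  have hroots : ∀ l ∈ Y.charpoly.roots, IsIntegral O l := fun l hl => by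
    have hspec : l ∈ spectrum K Y :=
      Matrix.mem_spectrum_of_isRoot_charpoly (Polynomial.isRoot_of_mem_roots hl)
    have hzero : (p.map (algebraMap O K)).eval l ∈ spectrum K _ :=
      spectrum.subset_polynomial_aeval Y _ ⟨l, hspec, rfl⟩
    rw [Polynomial.aeval_map_algebraMap, show Polynomial.aeval Y p = 0 from hpY,
      spectrum.zero_eq, Set.mem_singleton_iff, Polynomial.eval_map] at hzero
    exact ⟨p, hp, hzero⟩
  have htrace : algebraMap F K X.trace = Y.trace :=
    AddMonoidHom.map_trace (algebraMap F K).toAddMonoidHom X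
  rw [← isIntegral_algebraMap_iff (algebraMap F K).injective, htrace,
    Matrix.trace_eq_sum_roots_charpoly]
  exact IsIntegral.multiset_sum hroots

variable {A : Type u} [CommRing A] {H : Type v} [Ring H] [Algebra A H] {t : H →ₗ[A] A}

theorem IsSymmetrizing.exists_dualBasis {κ : Type*} [Finite κ] [DecidableEq κ]
    (ht : IsSymmetrizing t) (b : Module.Basis κ A H) :
    ∃ b' : Module.Basis κ A H, ∀ j l, t (b' j * b l) = if j = l then 1 else 0 := by
  let T : H ≃ₗ[A] Module.Dual A H :=
    LinearEquiv.ofBijective (LinearMap.compRight A t ∘ₗ LinearMap.mul A H) ht.bijective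
  refine ⟨b.dualBasis.map T.symm, fun j l => ?_⟩
  have hT : T (b.dualBasis.map T.symm j) = b.dualBasis j := by simp
  rw [show t (b.dualBasis.map T.symm j * b l) = T (b.dualBasis.map T.symm j) (b l) from rfl, hT,
    Module.Basis.dualBasis_apply, Module.Basis.repr_self, Finsupp.single_apply]
  simp only [eq_comm]

variable [IsDomain A]

theorem extendForm_tmul (t : H →ₗ[A] A) (x : FractionRing A) (h : H) :
    extendForm t (x ⊗ₜ h) = x * algebraMap A (FractionRing A) (t h) := by
  simp [extendForm, Algebra.smul_def, mul_comm]

theorem sum_extendForm_smul_eq {κ : Type*} [Fintype κ] [DecidableEq κ] {b : κ → H}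
    (b' : Module.Basis κ A H) (hb : ∀ j l, t (b' j * b l) = if j = l then 1 else 0)
    (x : GenericFiber A H) : ∑ l, extendForm t (x * 1 ⊗ₜ b l) • (1 ⊗ₜ b' l) = x := by
  let B := Algebra.TensorProduct.basis (FractionRing A) b'
  have hcoord (l : κ) : extendForm t (x * 1 ⊗ₜ b l) = B.repr x l := by
    have hterm (j : κ) :
        extendForm t ((B.repr x j • B j) * 1 ⊗ₜ b l) = if j = l then B.repr x j else 0 := by
      rw [Algebra.TensorProduct.basis_apply, smul_mul_assoc, map_smul,
        Algebra.TensorProduct.tmul_mul_tmul, extendForm_tmul, hb]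
      split_ifs <;> simp
    conv_lhs => rw [← B.sum_repr x, Finset.sum_mul, map_sum]
    rw [Finset.sum_congr rfl fun j _ => hterm j, Finset.sum_ite_eq' _ l, if_pos (Finset.mem_univ l)]
  simp_rw [hcoord, ← Algebra.TensorProduct.basis_apply]
  exact B.sum_repr x

section Dual

variable [Module.Free A H] [Module.Finite A H]

theorem IsSymmetrizing.eq_zero_of_forall (ht : IsSymmetrizing t) {x : GenericFiber A H}
    (hx : ∀ y, extendForm t (x * y) = 0) : x = 0 := by
  classical
  obtain ⟨b', hb'⟩ := ht.exists_dualBasis (Module.Free.chooseBasis A H)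
  rw [← sum_extendForm_smul_eq b' hb' x]
  exact Finset.sum_eq_zero fun l _ => by rw [hx, zero_smul]

theorem IsSymmetrizing.exists_smul_eq_one_tmul (ht : IsSymmetrizing t) (M : Submonoid A)
    {x : GenericFiber A H} (hx : ∀ h : H, ∃ v ∈ M, ∃ a : A,
      v • extendForm t (x * 1 ⊗ₜ h) = algebraMap A (FractionRing A) a) :
    ∃ v ∈ M, ∃ h : H, v • x = 1 ⊗ₜ h := by
  classical
  let b := Module.Free.chooseBasis A H
  obtain ⟨b', hb'⟩ := ht.exists_dualBasis b
  choose v hv a ha using fun l => hx (b l)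
  refine ⟨∏ l, v l, prod_mem fun l _ => hv l,
    ∑ l, ((∏ j ∈ Finset.univ.erase l, v j) * a l) • b' l, ?_⟩
  conv_lhs => rw [← sum_extendForm_smul_eq b' hb' x]
  rw [Finset.smul_sum, TensorProduct.tmul_sum]
  refine Finset.sum_congr rfl fun l hl => ?_
  rw [← Finset.prod_erase_mul _ _ hl, mul_smul, ← smul_assoc (v l), ha, TensorProduct.tmul_smul,
    mul_smul, algebraMap_smul]

end Dual

variable {ι : Type*} {d : ι → ℕ}
  (Φ : GenericFiber A H ≃ₐ[FractionRing A] MatrixProd d (FractionRing A))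

theorem exists_algebraMap_eq_trace [IsIntegrallyClosed A] [Module.Finite A H] (h : H) (i : ι) :
    ∃ a : A, algebraMap A (FractionRing A) a = (rep Φ h i).trace := by
  have hintegral : IsIntegral A (rep Φ h i) :=
    (Algebra.IsIntegral.isIntegral (R := A) h).map
      ((Pi.evalAlgHom A (fun i => Matrix (Fin (d i)) (Fin (d i)) (FractionRing A)) i).comp (rep Φ))
  exact IsIntegrallyClosed.isIntegral_iff.1 (isIntegral_trace_of_isIntegral hintegral)

variable [Finite ι] [∀ i, NeZero (d i)] [Module.Free A H] [Module.Finite A H]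

theorem IsSymmetrizing.mul_extendForm_unitOn_singleton (ht : IsSymmetrizing t) {i : ι}
    {s : FractionRing A} (hs : IsSchurElement t (irrEquiv.{u, v} Φ i) s) (x : GenericFiber A H) :
    s * extendForm t (Φ.symm (unitOn d _ {i}) * x) = (Φ x i).trace := by
  obtain ⟨c, hc, hact⟩ := hs
  rw [actsAsScalar_irrEquiv_iff] at hact
  simp only [irrEquiv_apply] at hc
  have hci : c * Φ.symm (1 - unitOn d _ {i}) = 0 := ht.eq_zero_of_forall fun y => by
    rw [mul_assoc, hc, map_mul, AlgEquiv.apply_symm_apply, Pi.mul_apply, Pi.sub_apply,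
      Pi.one_apply, unitOn_apply_of_mem (Set.mem_singleton i), sub_self, zero_mul,
      Matrix.trace_zero]
  have hcs : c = s • Φ.symm (unitOn d _ {i}) := by
    rw [map_sub, map_one, mul_sub, mul_one, sub_eq_zero] at hci
    apply Φ.injective
    rw [hci, map_mul, map_smul, AlgEquiv.apply_symm_apply]
    ext j : 1
    rcases eq_or_ne j i with rfl | hj
    · rw [Pi.mul_apply, hact, Pi.smul_apply, unitOn_apply_of_mem (Set.mem_singleton j), mul_one]
    · rw [Pi.mul_apply, Pi.smul_apply, unitOn_apply_of_notMem (Set.mem_singleton_iff.not.2 hj),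
        mul_zero, smul_zero]
  rw [← hc, hcs, smul_mul_assoc, map_smul, smul_eq_mul]

variable {Φ} in
theorem IsSymmetrizing.schurElement_ne_zero (ht : IsSymmetrizing t) {i : ι}
    {s : FractionRing A} (hs : IsSchurElement t (irrEquiv.{u, v} Φ i) s) : s ≠ 0 := by
  classical
  rintro rfl
  have htrace := ht.mul_extendForm_unitOn_singleton Φ hs
    (Φ.symm (Pi.single i (Matrix.single 0 0 1)))
  rw [zero_mul, AlgEquiv.apply_symm_apply, Pi.single_eq_same, Matrix.trace_single_eq_same]
    at htrace
  exact zero_ne_one htrace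

theorem IsSymmetrizing.extendForm_eq_sum [Fintype ι] (ht : IsSymmetrizing t)
    {s : ι → FractionRing A} (hs : ∀ i, IsSchurElement t (irrEquiv.{u, v} Φ i) (s i))
    (x : GenericFiber A H) : extendForm t x = ∑ i, (s i)⁻¹ * (Φ x i).trace := by
  have hone : ∑ i, unitOn d (FractionRing A) {i} = 1 := by
    ext j : 1
    rw [Finset.sum_apply, Finset.sum_eq_single_of_mem j (Finset.mem_univ j) fun i _ hij =>
      unitOn_apply_of_notMem fun hji : j ∈ {i} => hij hji.symm,
      unitOn_apply_of_mem (Set.mem_singleton j), Pi.one_apply]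
  have hx : x = ∑ i, Φ.symm (unitOn d _ {i}) * x := by
    rw [← Finset.sum_mul, ← map_sum, hone, map_one, one_mul]
  conv_lhs => rw [hx, map_sum]
  refine Finset.sum_congr rfl fun i _ => ?_
  rw [← ht.mul_extendForm_unitOn_singleton Φ (hs i),
    inv_mul_cancel_left₀ (ht.schurElement_ne_zero (hs i))]

theorem IsSymmetrizing.exists_prod_smul_extendForm_eq [IsIntegrallyClosed A]
    (ht : IsSymmetrizing t) {s : ι → A}
    (hs : ∀ i, IsSchurElement t (irrEquiv.{u, v} Φ i) (algebraMap A _ (s i))) (T : Finset ι)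
    (h : H) : ∃ a, (∏ i ∈ T, s i) • extendForm t (Φ.symm (unitOn d _ T) * 1 ⊗ₜ h) =
      algebraMap A (FractionRing A) a := by
  classical
  cases nonempty_fintype ι
  choose c hc using exists_algebraMap_eq_trace Φ h
  refine ⟨∑ i ∈ T, (∏ j ∈ T.erase i, s j) * c i, ?_⟩
  have hform : extendForm t (Φ.symm (unitOn d _ T) * 1 ⊗ₜ h) =
      ∑ i ∈ T, (algebraMap A (FractionRing A) (s i))⁻¹ * algebraMap A _ (c i) := by
    rw [ht.extendForm_eq_sum Φ hs, ← Finset.sum_subset T.subset_univ fun i _ hi => ?_]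
    · refine Finset.sum_congr rfl fun i hi => ?_
      rw [map_mul, AlgEquiv.apply_symm_apply, Pi.mul_apply, unitOn_apply_of_mem hi, one_mul, hc,
        rep_apply]
    · rw [map_mul, AlgEquiv.apply_symm_apply, Pi.mul_apply, unitOn_apply_of_notMem hi, zero_mul,
        Matrix.trace_zero, mul_zero]
  rw [hform, Finset.smul_sum, map_sum]
  refine Finset.sum_congr rfl fun i hi => ?_
  rw [← Finset.prod_erase_mul _ _ hi, Algebra.smul_def, map_mul, map_mul, mul_assoc,
    mul_inv_cancel_left₀ (ht.schurElement_ne_zero (hs i))]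

end Schur

/-! ### Comparison of the blocks at `𝔭A` and at `𝔮_M` -/

section Comparison

variable {R : Type u} [CommRing R] {n : ℕ} {p : Ideal R} {a : Fin n → ℤ}

theorem algebraMap_notMem_monomialIdeal (ha : IsPrimitiveExponent a) {c : R} (hc : c ∉ p) :
    algebraMap R (Laurent R n) c ∉ monomialIdeal p a := by
  have hiff := aeval_monomial_mem_monomialIdeal_iff (p := p) ha (AddSubgroup.mem_zmultiples a)
    (Polynomial.C c)
  rw [Polynomial.aeval_C, Polynomial.eval_C] at hiff
  exact hiff.not.2 hc

theorem exists_notMem_monomialIdeal_smul_eq_algebraMap [IsDomain R] (hp : p.IsPrime)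
    (ha : IsPrimitiveExponent a) {z : FractionRing (Laurent R n)} {ξ : R} (hξ : ξ ≠ 0)
    {g y v c : Laurent R n} (hg : g ∉ monomialIdeal p a)
    (hy : (algebraMap R (Laurent R n) ξ * g) • z = algebraMap _ _ y)
    (hv : v ∉ extendedIdeal p n) (hc : v • z = algebraMap _ _ c) :
    ∃ w ∉ monomialIdeal p a, ∃ b, w • z = algebraMap (Laurent R n) _ b := by
  have hinj := IsFractionRing.injective (Laurent R n) (FractionRing (Laurent R n))
  have hmem (x : Laurent R n) :
      x ∈ extendedIdeal (Ideal.span {ξ}) n ↔ algebraMap R (Laurent R n) ξ ∣ x := by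
    rw [extendedIdeal, Ideal.map_span, Set.image_singleton, Ideal.mem_span_singleton]
  have hyv : y * v = algebraMap R (Laurent R n) ξ * (g * c) := hinj <| by
    rw [map_mul, map_mul, map_mul, ← hy, ← hc, Algebra.smul_def, Algebra.smul_def, map_mul]
    ring
  obtain ⟨e, he, hey⟩ := exists_notMem_mul_mem_extendedIdeal hp hv ((hmem _).2 ⟨_, hyv⟩)
  obtain ⟨b, hb⟩ := (hmem _).1 hey
  refine ⟨algebraMap R _ e * g, fun h => ?_, b, ?_⟩
  · exact ((monomialIdeal_isPrime p hp a ha).mem_or_mem h).elim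
      (algebraMap_notMem_monomialIdeal ha he) hg
  · have hξ' : algebraMap (Laurent R n) (FractionRing (Laurent R n)) (algebraMap R _ ξ) ≠ 0 := by
      simpa using hξ
    apply mul_left_cancel₀ hξ'
    rw [← map_mul, ← hb, map_mul, ← hy, Algebra.smul_def, Algebra.smul_def, map_mul, map_mul]
    ring

variable {H : Type v} [Ring H] [Algebra (Laurent R n) H] {ι : Type*} {d : ι → ℕ}
  {Φ : GenericFiber (Laurent R n) H ≃ₐ[FractionRing (Laurent R n)]
    MatrixProd d (FractionRing (Laurent R n))}

theorem IsBlockUnionAt.extendedIdeal_of_monomialIdeal {S : Set ι}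
    (h : IsBlockUnionAt (rep Φ) (monomialIdeal p a) S) :
    IsBlockUnionAt (rep Φ) (extendedIdeal p n) S := by
  obtain ⟨v, hv, h, hh⟩ := h
  exact ⟨v, fun hv' => hv (Ideal.mem_sup_right hv'), h, hh⟩

variable [Finite ι] [∀ i, NeZero (d i)] [Module.Free (Laurent R n) H]
  [Module.Finite (Laurent R n) H] [IsDomain R] [IsIntegrallyClosed R]

/-- The idempotent has the product of the Schur elements as a denominator. The cofactors of the
constants `ξ_χ` lie outside of `𝔮_M`, and the constants are removed by the Gauss lemma, since the
idempotent also has a denominator outside of `𝔭A`. -/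
theorem IsBlockUnionAt.monomialIdeal_of_extendedIdeal {t : H →ₗ[Laurent R n] Laurent R n}
    (ht : IsSymmetrizing t) (hess : IsEssential t) (hp : p.IsPrime) (ha : IsPrimitiveExponent a)
    {S : Set ι} (hS : ∀ i ∈ S, ¬ IsEssentialMonomial t p a (irrEquiv.{u, v} Φ i))
    (h : IsBlockUnionAt (rep Φ) (extendedIdeal p n) S) :
    IsBlockUnionAt (rep Φ) (monomialIdeal p a) S := by
  have _ := isIntegrallyClosed_laurent R n
  have hq := monomialIdeal_isPrime p hp a ha
  choose D hD using fun i => hess (irrEquiv.{u, v} Φ i)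
  obtain ⟨v, hv, k, hk⟩ := h
  lift S to Finset ι using S.toFinite
  have hξ : ∏ i ∈ S, (D i).ξ ≠ 0 := Finset.prod_ne_zero_iff.2 fun i _ h0 =>
    ht.schurElement_ne_zero (hD i) <| by rw [(D i).value_eq, h0, map_zero, zero_mul, map_zero]
  have hg : ∏ i ∈ S, (D i).cofactor ∉ monomialIdeal p a := fun hmem => by
    obtain ⟨i, hi, hi'⟩ := hq.prod_mem_iff.1 hmem
    exact (D i).cofactor_notMem hp ha
      (eval_one_notMem_of_not_isEssentialMonomial (hS i hi) (D i) (hD i)) hi'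
  have hval : ∏ i ∈ S, (D i).value =
      algebraMap R (Laurent R n) (∏ i ∈ S, (D i).ξ) * ∏ i ∈ S, (D i).cofactor := by
    rw [map_prod, ← Finset.prod_mul_distrib]
    exact Finset.prod_congr rfl fun i _ => (D i).value_eq
  obtain ⟨w, hw, l, hl⟩ := ht.exists_smul_eq_one_tmul (monomialIdeal p a).primeCompl
    (x := Φ.symm (unitOn d _ S)) fun h => by
      obtain ⟨y, hy⟩ := ht.exists_prod_smul_extendForm_eq Φ hD S h
      refine exists_notMem_monomialIdeal_smul_eq_algebraMap hp ha hξ hg (hval ▸ hy) hv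
        (c := t (k * h)) ?_
      rw [← algebraMap_smul (FractionRing (Laurent R n)), ← map_smul, algebraMap_smul,
        ← smul_mul_assoc, (rep_eq_smul_iff Φ).1 hk, Algebra.TensorProduct.tmul_mul_tmul, one_mul,
        extendForm_tmul, one_mul]
  exact ⟨w, hw, l, (rep_eq_smul_iff Φ).2 hl⟩

end Comparison

/-! ### Integral matrix representations -/

section IntegralModel

open scoped Matrix

variable {O F Λ : Type*} [CommRing O] [Field F] [Algebra O F] [Ring Λ] [Algebra O Λ] {n : ℕ}

theorem exists_isLattice_forall_mulVec_mem [Module.Finite O Λ]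
    (ρ : Λ →ₐ[O] Matrix (Fin n) (Fin n) F) :
    ∃ L : Submodule O (Fin n → F), Submodule.IsLattice F L ∧ ∀ x, ∀ y ∈ L, ρ x *ᵥ y ∈ L := by
  let T (k : Fin n) : Λ →ₗ[O] (Fin n → F) :=
    { toFun x := (ρ x).col k
      map_add' x y := by rw [map_add]; rfl
      map_smul' c x := by rw [map_smul]; rfl }
  let L := ⨆ k, LinearMap.range (T k)
  have hL (k x) : T k x ∈ L := Submodule.mem_iSup_of_mem k ⟨x, rfl⟩
  have hstab (x) : L ≤ L.comap ((ρ x).mulVecLin.restrictScalars O) := by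
    refine iSup_le fun k => ?_
    rintro _ ⟨y, rfl⟩
    have hxy : ρ x *ᵥ T k y = T k (x * y) := by
      change _ = (ρ (x * y)).col k
      rw [map_mul]
      rfl
    exact Submodule.mem_comap.2 (hxy.symm ▸ hL k (x * y) : ρ x *ᵥ T k y ∈ L)
  refine ⟨L, ⟨Submodule.fg_iSup _ fun k => ?_, ?_⟩, fun x y hy => hstab x hy⟩
  · exact LinearMap.range_eq_map (T k) ▸ Module.Finite.fg_top.map (T k)
  · rw [eq_top_iff, ← (Pi.basisFun F (Fin n)).span_eq, Submodule.span_le]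
    rintro _ ⟨k, rfl⟩
    have hk : Pi.basisFun F (Fin n) k = T k 1 := by
      change _ = (ρ 1).col k
      ext j
      rw [map_one, Pi.basisFun_apply, Matrix.col_apply, Matrix.one_apply, Pi.single_apply]
    exact Submodule.subset_span (hk ▸ hL k 1)

variable [IsDomain O] [IsPrincipalIdealRing O] [IsFractionRing O F]

theorem exists_algEquiv_forall_mem_range_of_isLattice {L : Submodule O (Fin n → F)}
    [Submodule.IsLattice F L] :
    ∃ κ : Matrix (Fin n) (Fin n) F ≃ₐ[F] Matrix (Fin n) (Fin n) F,
      ∀ X, (∀ y ∈ L, X *ᵥ y ∈ L) → ∀ j k, κ X j k ∈ Set.range (algebraMap O F) := by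
  let b : Module.Basis (Fin n) O L := Module.finBasisOfFinrankEq O L
    ((Submodule.IsLattice.finrank_of_pi F L).trans (Fintype.card_fin n))
  let c := b.extendOfIsLattice F
  have hc (k) : c k = (b k : Fin n → F) := b.extendOfIsLattice_apply F k
  refine ⟨Matrix.toLinAlgEquiv'.trans (LinearMap.toMatrixAlgEquiv c), fun X hX j k => ?_⟩
  let y : L := ⟨X *ᵥ (b k : Fin n → F), hX _ (b k).2⟩
  have hy : X *ᵥ (b k : Fin n → F) = ∑ j, algebraMap O F (b.repr y j) • c j := by
    have hsum := congrArg Subtype.val (b.sum_repr y)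
    rw [Submodule.coe_sum] at hsum
    refine hsum.symm.trans (Finset.sum_congr rfl fun j _ => ?_)
    rw [hc, algebraMap_smul, Submodule.coe_smul]
  refine ⟨b.repr y j, ?_⟩
  rw [AlgEquiv.trans_apply, LinearMap.toMatrixAlgEquiv_apply, Matrix.toLinAlgEquiv'_apply, hc, hy,
    c.repr_sum_self]

theorem exists_algEquiv_forall_mem_range [Module.Finite O Λ]
    (ρ : Λ →ₐ[O] Matrix (Fin n) (Fin n) F) :
    ∃ κ : Matrix (Fin n) (Fin n) F ≃ₐ[F] Matrix (Fin n) (Fin n) F,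
      ∀ x j k, κ (ρ x) j k ∈ Set.range (algebraMap O F) := by
  obtain ⟨L, _, hL⟩ := exists_isLattice_forall_mulVec_mem ρ
  obtain ⟨κ, hκ⟩ := exists_algEquiv_forall_mem_range_of_isLattice (L := L)
  exact ⟨κ, fun x => hκ (ρ x) (hL x)⟩

theorem matrixProdMap_injective {A K L ι : Type*} [CommRing A] [CommRing K] [CommRing L]
    [Algebra A K] [Algebra A L] {d : ι → ℕ} {g : K →ₐ[A] L} (hg : Function.Injective g) :
    Function.Injective (matrixProdMap d g) := fun x y h => by
  ext i j k
  exact hg (congrFun₂ (congrFun h i) j k)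

variable (O) in
theorem exists_integralRep {A H ι : Type*} [CommRing A] [Ring H] [Algebra A H] {d : ι → ℕ}
    (Φ : GenericFiber A H ≃ₐ[FractionRing A] MatrixProd d (FractionRing A)) [Module.Finite A H]
    [IsDomain A] [Algebra A O] [Algebra O (FractionRing A)] [IsScalarTower A O (FractionRing A)]
    [IsFractionRing O (FractionRing A)] :
    ∃ (Φ' : GenericFiber A H ≃ₐ[FractionRing A] MatrixProd d (FractionRing A))
      (ρ : H →ₐ[A] MatrixProd d O),
      ∀ h, rep Φ' h = matrixProdMap d (Algebra.ofId O (FractionRing A)) (ρ h) := by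
  choose κ hκ using fun i => exists_algEquiv_forall_mem_range
    ((Pi.evalAlgHom O (fun i => Matrix (Fin (d i)) (Fin (d i)) (FractionRing A)) i).comp
      (liftRep (O := O) (rep Φ)))
  let Φ' := Φ.trans (AlgEquiv.piCongrRight κ)
  let g := matrixProdMap d (IsScalarTower.toAlgHom A O (FractionRing A))
  have hg : Function.Injective g := matrixProdMap_injective (IsFractionRing.injective O _)
  have hrange (h : H) : rep Φ' h ∈ g.range := by
    choose y hy using fun i j k => hκ i (1 ⊗ₜ h) j k
    refine ⟨fun i => Matrix.of fun j k => y i j k, ?_⟩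
    ext i j k
    refine (hy i j k).trans ?_
    rw [AlgHom.comp_apply, liftRep_tmul, one_smul]
    rfl
  let γ := AlgEquiv.ofInjective g hg
  exact ⟨Φ', γ.symm.toAlgHom.comp ((rep Φ').codRestrict g.range hrange), fun h =>
    congrArg Subtype.val (γ.apply_symm_apply ⟨rep Φ' h, hrange h⟩).symm⟩

end IntegralModel

section ValuationRing

theorem isNoetherianRing_localization_of_forall_notMem {R A : Type*} [CommRing R] [IsDomain R]
    [CommRing A] [Algebra R A] [Algebra.FiniteType R A] (q : Ideal A) [q.IsPrime]
    (hq : ∀ c : R, c ≠ 0 → algebraMap R A c ∉ q) :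
    IsNoetherianRing (Localization.AtPrime q) := by
  have hunit (c : nonZeroDivisors R) : IsUnit (algebraMap R (Localization.AtPrime q) c) := by
    rw [IsScalarTower.algebraMap_apply R A]
    exact IsLocalization.map_units (M := q.primeCompl) _
      ⟨_, hq c (nonZeroDivisors.coe_ne_zero c)⟩
  let := (IsLocalization.lift (S := FractionRing R) hunit).toAlgebra
  have : IsScalarTower R (FractionRing R) (Localization.AtPrime q) :=
    .of_algebraMap_eq fun c => (IsLocalization.lift_eq hunit c).symm
  have := Algebra.EssFiniteType.of_comp R (FractionRing R) (Localization.AtPrime q)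
  exact Algebra.EssFiniteType.isNoetherianRing (FractionRing R) _

theorem isPrincipalIdealRing_localization_monomialIdeal {R : Type u} [CommRing R] [IsDomain R]
    {n : ℕ} {a : Fin n → ℤ} (ha : IsPrimitiveExponent a)
    [(monomialIdeal (⊥ : Ideal R) a).IsPrime] :
    IsPrincipalIdealRing (Localization.AtPrime (monomialIdeal (⊥ : Ideal R) a)) := by
  let O := Localization.AtPrime (monomialIdeal (⊥ : Ideal R) a)
  have : IsDomain O := IsLocalization.isDomain_localization (Ideal.primeCompl_le_nonZeroDivisors _)
  have := isNoetherianRing_localization_of_forall_notMem (monomialIdeal (⊥ : Ideal R) a)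
    fun c hc => algebraMap_notMem_monomialIdeal ha (by simpa using hc)
  have hspan : monomialIdeal (⊥ : Ideal R) a = Ideal.span {monomial R a - 1} := by
    rw [monomialIdeal, extendedIdeal, Ideal.map_bot, sup_bot_eq]
  have hmax := congrArg (Ideal.map (algebraMap (Laurent R n) O)) hspan
  rw [Ideal.map_span, Set.image_singleton] at hmax
  refine ((tfae_of_isNoetherianRing_of_isLocalRing_of_isDomain O).out 0 4).2 ?_
  exact ⟨_, Localization.AtPrime.map_eq_maximalIdeal.symm.trans hmax⟩

end ValuationRing

/-! ### Specialization of matrix representations -/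

section SpecializeRep

variable {A : Type u} [CommRing A] {H : Type v} [Ring H] [Algebra A H] {ι : Type*} {d : ι → ℕ}

theorem finrank_matrixProd [Finite ι] (K : Type*) [Field K] :
    Module.finrank K (MatrixProd d K) = Nat.card (Σ i, Fin (d i) × Fin (d i)) :=
  Module.finrank_eq_nat_card_basis (matrixUnits d K)

theorem finrank_eq_card_of_algEquiv [IsDomain A] [Finite ι] [Module.Free A H]
    (Φ : GenericFiber A H ≃ₐ[FractionRing A] MatrixProd d (FractionRing A)) :
    Module.finrank A H = Nat.card (Σ i, Fin (d i) × Fin (d i)) := by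
  rw [← finrank_matrixProd (FractionRing A), ← Φ.toLinearEquiv.finrank_eq,
    Module.finrank_baseChange]

theorem liftRep_bijective_of_span_eq_top [Nontrivial A] [Finite ι] [Module.Free A H]
    [Module.Finite A H] {L : Type*} [Field L] [Algebra A L] {σ : H →ₐ[A] MatrixProd d L}
    (hdim : Module.finrank A H = Nat.card (Σ i, Fin (d i) × Fin (d i)))
    (hspan : Submodule.span L (Set.range σ) = ⊤) :
    Function.Bijective (liftRep (O := L) σ) := by
  have hsurj : Function.Surjective (liftRep (O := L) σ).toLinearMap := by
    rw [← LinearMap.range_eq_top, eq_top_iff, ← hspan, Submodule.span_le]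
    rintro _ ⟨h, rfl⟩
    exact ⟨1 ⊗ₜ h, by rw [AlgHom.toLinearMap_apply, liftRep_tmul, one_smul]⟩
  have hfinrank : Module.finrank L (L ⊗[A] H) = Module.finrank L (MatrixProd d L) := by
    rw [Module.finrank_baseChange, hdim, finrank_matrixProd]
  have := Module.Finite.of_basis (matrixUnits d L)
  exact ⟨(LinearMap.injective_iff_surjective_of_finrank_eq_finrank hfinrank).2 hsurj, hsurj⟩

variable [IsDomain A] {O : Type*} [CommRing O] [Algebra A O] [Algebra O (FractionRing A)]
  [IsScalarTower A O (FractionRing A)] {ρ : H →ₐ[A] MatrixProd d O}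
  {Φ : GenericFiber A H ≃ₐ[FractionRing A] MatrixProd d (FractionRing A)}

theorem exists_smul_extendForm_eq_of_rep_eq [Finite ι] [∀ i, NeZero (d i)] [Module.Free A H]
    [Module.Finite A H]
    (hρ : ∀ h, rep Φ h = matrixProdMap d (Algebra.ofId O (FractionRing A)) (ρ h))
    {t : H →ₗ[A] A} (ht : IsSymmetrizing t) (M : Submonoid A) [IsLocalization M O] {s : ι → A}
    (hs : ∀ i, IsSchurElement t (irrEquiv.{u, v} Φ i) (algebraMap A (FractionRing A) (s i)))
    (hsM : ∀ i, s i ∈ M) (Y : MatrixProd d O) (h : H) :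
    ∃ v ∈ M, ∃ a, v • extendForm t
      (Φ.symm (matrixProdMap d (Algebra.ofId O (FractionRing A)) Y) * 1 ⊗ₜ h) =
        algebraMap A (FractionRing A) a := by
  cases nonempty_fintype ι
  have hinv (i : ι) : (algebraMap A (FractionRing A) (s i))⁻¹ =
      algebraMap O _ (IsLocalization.mk' O 1 ⟨s i, hsM i⟩) := by
    refine (eq_inv_of_mul_eq_one_left ?_).symm
    rw [IsScalarTower.algebraMap_apply A O, ← map_mul, IsLocalization.mk'_spec, map_one, map_one]
  let o : O := ∑ i, IsLocalization.mk' O 1 ⟨s i, hsM i⟩ * (Y i * ρ h i).trace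
  have ho : extendForm t
      (Φ.symm (matrixProdMap d (Algebra.ofId O (FractionRing A)) Y) * 1 ⊗ₜ h) =
        algebraMap O _ o := by
    rw [ht.extendForm_eq_sum Φ hs, map_sum]
    refine Finset.sum_congr rfl fun i _ => ?_
    rw [hinv, map_mul, map_mul, AlgEquiv.apply_symm_apply, ← rep_apply, hρ, ← map_mul,
      matrixProdMap_apply]
    exact congrArg _ (AddMonoidHom.map_trace (algebraMap O (FractionRing A)).toAddMonoidHom _).symm
  obtain ⟨⟨a, v⟩, hav⟩ := IsLocalization.surj M o
  refine ⟨v, v.2, a, ?_⟩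
  rw [ho, Algebra.smul_def, IsScalarTower.algebraMap_apply A O, ← map_mul, mul_comm, hav,
    ← IsScalarTower.algebraMap_apply]

theorem IsSymmetrizing.span_range_integralRep_eq_top [Finite ι] [∀ i, NeZero (d i)]
    [Module.Free A H] [Module.Finite A H] [FaithfulSMul O (FractionRing A)]
    (hρ : ∀ h, rep Φ h = matrixProdMap d (Algebra.ofId O (FractionRing A)) (ρ h))
    {t : H →ₗ[A] A} (ht : IsSymmetrizing t) (M : Submonoid A) [IsLocalization M O] {s : ι → A}
    (hs : ∀ i, IsSchurElement t (irrEquiv.{u, v} Φ i) (algebraMap A (FractionRing A) (s i)))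
    (hsM : ∀ i, s i ∈ M) : Submodule.span O (Set.range ρ) = ⊤ := by
  refine eq_top_iff.2 fun Y _ => ?_
  obtain ⟨v, hv, h, hh⟩ := ht.exists_smul_eq_one_tmul M
    (exists_smul_extendForm_eq_of_rep_eq hρ ht M hs hsM Y)
  have hinj := matrixProdMap_injective (d := d) (g := Algebra.ofId O (FractionRing A))
    (FaithfulSMul.algebraMap_injective O _)
  have hY : Y = IsLocalization.mk' O 1 ⟨v, hv⟩ • ρ h := by
    have hvY : ρ h = algebraMap A O v • Y := hinj <| by
      rw [← hρ, map_smul, algebraMap_smul]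
      exact (rep_eq_smul_iff Φ).2 hh
    rw [hvY, smul_smul, IsLocalization.mk'_spec O 1 ⟨v, hv⟩, map_one, one_smul]
  exact hY ▸ Submodule.smul_mem _ _ (Submodule.subset_span ⟨h, rfl⟩)

end SpecializeRep

section IsCompatible

variable {A B : Type u} [CommRing A] [CommRing B] {H : Type v} [Ring H] [Algebra A H]
  {ι : Type*} {d : ι → ℕ} (φ : A →+* B) {O : Type*} [CommRing O] [Algebra A O]
  [Algebra O (FractionRing B)] {ρ : H →ₐ[A] MatrixProd d O}

theorem exists_rep_eq_of_span_eq_top [IsDomain A] [IsDomain B] [Finite ι] [Module.Free A H]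
    [Module.Finite A H]
    (hdim : Module.finrank A H = Nat.card (Σ i, Fin (d i) × Fin (d i)))
    (hO : ∀ x : A, algebraMap O (FractionRing B) (algebraMap A O x) = algebraMap B _ (φ x))
    (hspan : Submodule.span O (Set.range ρ) = ⊤) :
    ∃ Φ' : GenericFiber B (Specialization φ H) ≃ₐ[FractionRing B] MatrixProd d (FractionRing B),
      ∀ h, rep Φ' (Specialization.of φ h) =
        matrixProdMap d (Algebra.ofId O (FractionRing B)) (ρ h) := by
  let _ : Algebra A B := φ.toAlgebra
  have : IsScalarTower A O (FractionRing B) := .of_algebraMap_eq fun x => (hO x).symm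
  let σ : H →ₐ[A] MatrixProd d (FractionRing B) :=
    (matrixProdMap d (IsScalarTower.toAlgHom A O (FractionRing B))).comp ρ
  have hσ : Submodule.span (FractionRing B) (Set.range (liftRep (O := B) σ)) = ⊤ := by
    refine eq_top_iff.2 ((span_image_matrixProdMap (K := FractionRing B) hspan).ge.trans
      (Submodule.span_mono ?_))
    rintro _ ⟨_, ⟨h, rfl⟩, rfl⟩
    exact ⟨1 ⊗ₜ h, by rw [liftRep_tmul, one_smul]; rfl⟩
  have hdim' : Module.finrank B (B ⊗[A] H) = Nat.card (Σ i, Fin (d i) × Fin (d i)) := by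
    rw [Module.finrank_baseChange, hdim]
  let Φ' : GenericFiber B (Specialization φ H) ≃ₐ[FractionRing B] MatrixProd d (FractionRing B) :=
    AlgEquiv.ofBijective _ (liftRep_bijective_of_span_eq_top (H := B ⊗[A] H) hdim' hσ)
  refine ⟨Φ', fun h => ?_⟩
  refine (liftRep_tmul (liftRep (O := B) σ) (1 : FractionRing B) (1 ⊗ₜ h)).trans ?_
  rw [one_smul, liftRep_tmul, one_smul]
  rfl

/-- Splittings of the generic fibers of `H` and of `H_φ` are compatible if central idempotents and
traces of the elements of `H` correspond under `φ`. -/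
structure IsCompatible (φ : A →+* B)
    (Φ : GenericFiber A H ≃ₐ[FractionRing A] MatrixProd d (FractionRing A))
    (Φ' : GenericFiber B (Specialization φ H) ≃ₐ[FractionRing B] MatrixProd d (FractionRing B)) :
    Prop where
  unitOn (h : H) (v : A) (S : Set ι) : rep Φ h = v • unitOn d _ S →
    rep Φ' (Specialization.of φ h) = φ v • unitOn d _ S
  trace (h : H) (c : A) (i : ι) : algebraMap A (FractionRing A) c = (rep Φ h i).trace →
    algebraMap B (FractionRing B) (φ c) = (rep Φ' (Specialization.of φ h) i).trace

variable {φ} {Φ : GenericFiber A H ≃ₐ[FractionRing A] MatrixProd d (FractionRing A)}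
  {Φ' : GenericFiber B (Specialization φ H) ≃ₐ[FractionRing B] MatrixProd d (FractionRing B)}
  [Algebra O (FractionRing A)] [IsScalarTower A O (FractionRing A)]
  [FaithfulSMul O (FractionRing A)]

theorem isCompatible_of_rep_eq
    (hO : ∀ x : A, algebraMap O (FractionRing B) (algebraMap A O x) = algebraMap B _ (φ x))
    (hΦ : ∀ h, rep Φ h = matrixProdMap d (Algebra.ofId O (FractionRing A)) (ρ h))
    (hΦ' : ∀ h, rep Φ' (Specialization.of φ h) =
      matrixProdMap d (Algebra.ofId O (FractionRing B)) (ρ h)) : IsCompatible φ Φ Φ' where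
  unitOn h v S hh := by
    have hρ : ρ h = algebraMap A O v • unitOn d O S :=
      matrixProdMap_injective (g := Algebra.ofId O (FractionRing A))
        (FaithfulSMul.algebraMap_injective O _) <| by
          rw [← hΦ, hh, map_smul, matrixProdMap_unitOn, algebraMap_smul]
    rw [hΦ', hρ, map_smul, matrixProdMap_unitOn, ← algebraMap_smul (FractionRing B), hO,
      algebraMap_smul]
  trace h c i hc := by
    have hρ : algebraMap A O c = (ρ h i).trace :=
      FaithfulSMul.algebraMap_injective O (FractionRing A) <| by
        rw [← IsScalarTower.algebraMap_apply, hc, hΦ]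
        exact (AddMonoidHom.map_trace (algebraMap O (FractionRing A)).toAddMonoidHom _).symm
    rw [hΦ', ← hO, hρ]
    exact AddMonoidHom.map_trace (algebraMap O (FractionRing B)).toAddMonoidHom _

variable (φ) in
theorem IsSymmetrizing.exists_isCompatible [IsDomain A] [IsDomain B] [Finite ι]
    [∀ i, NeZero (d i)] [Module.Free A H] [Module.Finite A H] {t : H →ₗ[A] A}
    (ht : IsSymmetrizing t)
    (Φ₀ : GenericFiber A H ≃ₐ[FractionRing A] MatrixProd d (FractionRing A))
    (q : Ideal A) [q.IsPrime] [IsPrincipalIdealRing (Localization.AtPrime q)]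
    (hq : ∀ x, φ x = 0 ↔ x ∈ q)
    (hs : ∀ χ : IrrGeneric A H, ∃ s ∉ q, IsSchurElement t χ (algebraMap A (FractionRing A) s)) :
    ∃ (Φ : GenericFiber A H ≃ₐ[FractionRing A] MatrixProd d (FractionRing A))
      (Φ' : GenericFiber B (Specialization φ H) ≃ₐ[FractionRing B] MatrixProd d (FractionRing B)),
      IsCompatible φ Φ Φ' := by
  let O := Localization.AtPrime q
  have : IsDomain O := IsLocalization.isDomain_localization q.primeCompl_le_nonZeroDivisors
  have hunit (x : q.primeCompl) :
      IsUnit (((algebraMap B (FractionRing B)).comp φ) (x : A)) := by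
    simpa using (hq x).not.2 x.2
  let _ : Algebra O (FractionRing B) := (IsLocalization.lift hunit).toAlgebra
  have hO (x : A) : algebraMap O (FractionRing B) (algebraMap A O x) = algebraMap B _ (φ x) :=
    IsLocalization.lift_eq hunit x
  obtain ⟨Φ, ρ, hρ⟩ := exists_integralRep O Φ₀
  choose s hsq hs using fun i => hs (irrEquiv.{u, v} Φ i)
  obtain ⟨Φ', hΦ'⟩ := exists_rep_eq_of_span_eq_top φ (finrank_eq_card_of_algEquiv Φ) hO
    (ht.span_range_integralRep_eq_top hρ q.primeCompl hs hsq)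
  exact ⟨Φ, Φ', isCompatible_of_rep_eq hO hρ hΦ'⟩

end IsCompatible

/-! ### Lifting idempotents of the specialized algebra -/

section Separation

variable {B : Type*} [CommRing B] {Λ : Type*} [Ring Λ] [Algebra B Λ] [Module.Finite B Λ] {L : Type*}
  [Field L] [Algebra B L] [FaithfulSMul B L] {ι : Type*} {d : ι → ℕ} [∀ i, NeZero (d i)]
  {σ : Λ →ₐ[B] MatrixProd d L} {q : Ideal B} [q.IsPrime]

theorem subset_of_smul_unitOn_sub_mem {g : Λ} (hg : g ∈ q • (⊤ : Submodule B Λ)) {c : B}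
    (hc : c ∉ q) {S T : Set ι} (hσ : σ g = c • (unitOn d L T - unitOn d L S)) : T ⊆ S := by
  intro i hi
  by_contra hiS
  let ev := (Pi.evalAlgHom B (fun i => Matrix (Fin (d i)) (Fin (d i)) L) i).comp σ
  have hev : ev g = algebraMap L _ (algebraMap B L c) := by
    change σ g i = _
    rw [hσ, Pi.smul_apply, Pi.sub_apply, unitOn_apply_of_mem hi, unitOn_apply_of_notMem hiS,
      sub_zero, ← IsScalarTower.algebraMap_apply, Algebra.algebraMap_eq_smul_one]
  refine hc (mem_of_algebraMap_mem_spectrum ev hg (K := L) ?_)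
  rw [hev, spectrum.scalar_eq]
  exact Set.mem_singleton _

theorem eq_of_smul_unitOn_sub_mem {g : Λ} (hg : g ∈ q • (⊤ : Submodule B Λ)) {c : B}
    (hc : c ∉ q) {S T : Set ι} (hσ : σ g = c • (unitOn d L T - unitOn d L S)) : T = S :=
  (subset_of_smul_unitOn_sub_mem hg hc hσ).antisymm <|
    subset_of_smul_unitOn_sub_mem (neg_mem hg) hc (σ := σ) <| by
      rw [map_neg, hσ, ← smul_neg, neg_sub]

end Separation

namespace Specialization

variable {A B : Type u} [CommRing A] [CommRing B] (φ : A →+* B) {H : Type v} [Ring H] [Algebra A H]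

instance [Module.Finite A H] : Module.Finite B (Specialization φ H) :=
  letI := φ.toAlgebra
  (inferInstance : Module.Finite B (B ⊗[A] H))

instance [Module.Free A H] : Module.Free B (Specialization φ H) :=
  letI := φ.toAlgebra
  (inferInstance : Module.Free B (B ⊗[A] H))

/-- The canonical map `h ↦ 1 ⊗ h` as a ring morphism. -/
def ofHom : H →+* Specialization φ H :=
  letI := φ.toAlgebra
  (Algebra.TensorProduct.includeRight : H →ₐ[A] B ⊗[A] H).toRingHom

theorem ofHom_apply (h : H) : ofHom φ h = of φ h := rfl

theorem ofHom_smul (x : A) (h : H) : ofHom φ (x • h) = φ x • ofHom φ h := by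
  let _ := φ.toAlgebra
  change (1 : B) ⊗ₜ[A] (x • h) = (algebraMap A B x) • ((1 : B) ⊗ₜ[A] h)
  rw [TensorProduct.tmul_smul, algebraMap_smul]

variable {φ}

theorem ofHom_surjective (hφ : Function.Surjective φ) :
    Function.Surjective (ofHom φ : H → Specialization φ H) := by
  let _ := φ.toAlgebra
  exact Algebra.TensorProduct.includeRight_surjective H hφ

theorem mem_smul_top_of_ofHom_eq_zero [Module.Free A H] {q : Ideal A}
    (hq : ∀ x, φ x = 0 → x ∈ q) {h : H} (hh : ofHom φ h = 0) :
    h ∈ q • (⊤ : Submodule A H) := by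
  let _ := φ.toAlgebra
  let b := Module.Free.chooseBasis A H
  have h0 : (1 : B) ⊗ₜ[A] h = 0 := hh
  rw [← b.linearCombination_repr h, Finsupp.linearCombination_apply]
  refine Submodule.sum_mem _ fun i _ => Submodule.smul_mem_smul (hq _ ?_) trivial
  have hcoord := congrArg (fun z => (Algebra.TensorProduct.basis B b).repr z i) h0
  simp only [Algebra.TensorProduct.basis_repr_tmul, one_smul, map_zero, Finsupp.coe_zero,
    Pi.zero_apply, Finsupp.mapRange_apply] at hcoord
  exact hcoord

theorem ofHom_mem_smul_top {q : Ideal A} {q' : Ideal B} (hq : q ≤ q'.comap φ) {h : H}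
    (hh : h ∈ q • (⊤ : Submodule A H)) :
    ofHom φ h ∈ q' • (⊤ : Submodule B (Specialization φ H)) := by
  let _ := φ.toAlgebra
  exact Submodule.smul_mono_left (Ideal.map_le_iff_le_comap.2 hq) (tmul_mem_smul_top hh (1 : B))

end Specialization

section LiftBlockUnion

theorem exists_smul_eq_one_tmul_of_mem_smul_top {A S H : Type*} [CommRing A] [CommRing S]
    [Algebra A S] [AddCommGroup H] [Module A H] (M : Submonoid A) [IsLocalization M S]
    {I : Ideal A} {z : S ⊗[A] H} (hz : z ∈ I.map (algebraMap A S) • (⊤ : Submodule S (S ⊗[A] H))) :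
    ∃ u ∈ M, ∃ y ∈ I • (⊤ : Submodule A H), u • z = 1 ⊗ₜ[A] y := by
  refine Submodule.smul_induction_on hz (fun r hr n _ => ?_) fun x y hx hy => ?_
  · obtain ⟨⟨b, s⟩, hs⟩ := (IsLocalization.mem_map_algebraMap_iff M S).1 hr
    obtain ⟨s', hs', n', hn⟩ := exists_smul_eq_one_tmul M n
    refine ⟨s * s', M.mul_mem s.2 hs', (b : A) • n', Submodule.smul_mem_smul b.2 trivial, ?_⟩
    rw [mul_smul, smul_comm s' r, hn, TensorProduct.tmul_smul, ← smul_assoc,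
      ← algebraMap_smul S (b : A), ← hs, Algebra.smul_def, mul_comm]
  · obtain ⟨u, hu, x', hx', hux⟩ := hx
    obtain ⟨w, hw, y', hy', hwy⟩ := hy
    refine ⟨u * w, M.mul_mem hu hw, w • x' + u • y',
      add_mem (Submodule.smul_mem _ _ hx') (Submodule.smul_mem _ _ hy'), ?_⟩
    rw [smul_add, mul_comm, mul_smul, hux, mul_comm, mul_smul, hwy, TensorProduct.tmul_add,
      TensorProduct.tmul_smul, TensorProduct.tmul_smul]

variable {A B : Type u} [CommRing A] [CommRing B] {φ : A →+* B} {H : Type v} [Ring H] [Algebra A H]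
  {ι : Type*} {d : ι → ℕ}
  {Φ : GenericFiber A H ≃ₐ[FractionRing A] MatrixProd d (FractionRing A)}
  {Φ' : GenericFiber B (Specialization φ H) ≃ₐ[FractionRing B] MatrixProd d (FractionRing B)}
  {q : Ideal A} {q' : Ideal B} {S : Set ι}

theorem IsBlockUnionAt.specialize (hΦ : IsCompatible φ Φ Φ') (hq : q'.comap φ ≤ q)
    (hS : IsBlockUnionAt (rep Φ) q S) : IsBlockUnionAt (rep Φ') q' S := by
  obtain ⟨v, hv, h, hh⟩ := hS
  exact ⟨φ v, fun h0 => hv (hq h0), _, hΦ.unitOn h v S hh⟩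

theorem exists_mod_of_specialize [IsDomain B] [Module.Free A H] (hφ : Function.Surjective φ)
    (hq : q'.comap φ = q) (hS : IsBlockUnionAt (rep Φ') q' S) :
    ∃ v ∉ q, ∃ h, rep Φ' (Specialization.ofHom φ h) = φ v • unitOn d _ S ∧
      h * h - v • h ∈ q • (⊤ : Submodule A H) ∧
      ∀ k, h * k - k * h ∈ q • (⊤ : Submodule A H) := by
  obtain ⟨v, hv, h, hh⟩ := hS
  obtain ⟨v, rfl⟩ := hφ v
  obtain ⟨h, rfl⟩ := Specialization.ofHom_surjective hφ h
  have hmem {y : H} (hy : rep Φ' (Specialization.ofHom φ y) = 0) :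
      y ∈ q • (⊤ : Submodule A H) :=
    Specialization.mem_smul_top_of_ofHom_eq_zero
      (fun x hx => hq ▸ Ideal.mem_comap.2 (hx ▸ q'.zero_mem))
      (rep_injective Φ' (hy.trans (map_zero _).symm))
  refine ⟨v, hq ▸ hv, h, hh, hmem ?_, fun k => hmem ?_⟩
  · rw [map_sub, map_mul, Specialization.ofHom_smul, map_sub, map_mul, map_smul, hh,
      smul_mul_smul_comm, unitOn_mul, Set.inter_self, smul_smul, sub_self]
  · rw [map_sub, map_mul, map_mul, map_sub, map_mul, map_mul, hh, smul_mul_assoc, mul_smul_comm,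
      (unitOn_commute S _).eq, sub_self]

variable [IsDomain A] [Module.Free A H] [Module.Finite A H] [Finite ι]

variable (Φ) in
theorem exists_rep_eq_smul_unitOn_of_mod [IsIntegrallyClosed A] [q.IsPrime] {h : H} {v : A}
    (hv : v ∉ q) (hidem : h * h - v • h ∈ q • (⊤ : Submodule A H))
    (hcomm : ∀ k, h * k - k * h ∈ q • (⊤ : Submodule A H)) :
    ∃ T, ∃ w ∉ q, ∃ k, rep Φ k = w • unitOn d _ T ∧
      ∃ u ∉ q, u • (v • k - w • h) ∈ q • (⊤ : Submodule A H) := by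
  let O := Localization.AtPrime q
  let c : O := IsLocalization.mk' O 1 (⟨v, hv⟩ : q.primeCompl)
  have hcv : v • c = 1 := by
    rw [Algebra.smul_def]
    exact (IsLocalization.mk'_spec' O 1 (⟨v, hv⟩ : q.primeCompl)).trans (map_one _)
  have hf := isCentralIdempotentMod_tmul hcv hidem hcomm
  rw [Localization.AtPrime.map_eq_maximalIdeal] at hf
  obtain ⟨T, e, he, hef⟩ := exists_unitOn_sub_mem_smul_top (span_range_localizedRep Φ q) hf
  rw [← Localization.AtPrime.map_eq_maximalIdeal] at hef
  obtain ⟨w, hw, k, hk⟩ := exists_smul_eq_one_tmul q.primeCompl e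
  obtain ⟨u, hu, y, hy, huy⟩ := exists_smul_eq_one_tmul_of_mem_smul_top q.primeCompl hef
  have hkT : rep Φ k = w • unitOn d _ T := by
    rw [← he, ← one_smul O (rep Φ k), ← liftRep_tmul, ← hk, ← algebraMap_smul O, map_smul,
      algebraMap_smul]
  have hvf : v • c ⊗ₜ[A] h = 1 ⊗ₜ h := by rw [TensorProduct.smul_tmul', hcv]
  have hdiff : u • (v • k - w • h) = (v * w) • y :=
    Algebra.TensorProduct.includeRight_injective (A := O)
      (FaithfulSMul.algebraMap_injective A O) <| by
        change (1 : O) ⊗ₜ[A] _ = 1 ⊗ₜ[A] _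
        rw [TensorProduct.tmul_smul, TensorProduct.tmul_sub, TensorProduct.tmul_smul,
          TensorProduct.tmul_smul, TensorProduct.tmul_smul, ← huy, ← hk, ← hvf]
        module
  exact ⟨T, w, hw, k, hkT, u, hu, hdiff ▸ Submodule.smul_mem _ _ hy⟩

theorem IsBlockUnionAt.of_specialize [IsDomain B] [IsIntegrallyClosed A] [∀ i, NeZero (d i)]
    [q'.IsPrime] (hΦ : IsCompatible φ Φ Φ') (hφ : Function.Surjective φ) (hq : q'.comap φ = q)
    (hS : IsBlockUnionAt (rep Φ') q' S) : IsBlockUnionAt (rep Φ) q S := by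
  have hprime : q.IsPrime := hq ▸ inferInstance
  obtain ⟨v, hv, h, hh, hidem, hcomm⟩ := exists_mod_of_specialize hφ hq hS
  obtain ⟨T, w, hw, k, hk, u, hu, hmem⟩ := exists_rep_eq_smul_unitOn_of_mod Φ hv hidem hcomm
  have huvw : φ (u * (v * w)) ∉ q' := fun h0 => by
    rw [← Ideal.mem_comap, hq] at h0
    exact q.primeCompl.mul_mem hu (q.primeCompl.mul_mem hv hw) h0
  have hdiff : rep Φ' (Specialization.ofHom φ (u • (v • k - w • h))) =
      φ (u * (v * w)) • (unitOn d _ T - unitOn d _ S) := by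
    rw [Specialization.ofHom_smul, map_sub, Specialization.ofHom_smul, Specialization.ofHom_smul,
      map_smul, map_sub, map_smul, map_smul, hh, Specialization.ofHom_apply, hΦ.unitOn k w T hk,
      smul_smul, smul_smul, ← map_mul, ← map_mul, mul_comm w v, ← smul_sub, smul_smul, ← map_mul]
  have hTS : T = S :=
    eq_of_smul_unitOn_sub_mem (Specialization.ofHom_mem_smul_top hq.ge hmem) huvw hdiff
  exact ⟨w, hw, k, hTS ▸ hk⟩

end LiftBlockUnion

/-! ### Blocks and essential monomials -/

section EssentialBlocks

variable {R : Type u} [CommRing R] [IsDomain R] {n : ℕ} {H : Type v} [Ring H]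
  [Algebra (Laurent R n) H] [Module.Free (Laurent R n) H] [Module.Finite (Laurent R n) H]
  {t : H →ₗ[Laurent R n] Laurent R n} {p : Ideal R} {a : Fin n → ℤ}

theorem IsEssential.exists_isSchurElement_notMem (hess : IsEssential t) (ht : IsSymmetrizing t)
    (hH : IsSplitSemisimple (FractionRing (Laurent R n)) (GenericFiber (Laurent R n) H))
    (ha : IsPrimitiveExponent a) (χ : IrrGeneric (Laurent R n) H) :
    ∃ s ∉ monomialIdeal (⊥ : Ideal R) a,
      IsSchurElement t χ (algebraMap _ (FractionRing (Laurent R n)) s) := by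
  obtain ⟨k, d, hd, ⟨Φ⟩⟩ := hH.exists_algEquiv_matrixProd
  obtain ⟨D, hD⟩ := hess χ
  obtain ⟨i, rfl⟩ := (irrEquiv.{u, v} Φ).surjective χ
  have hbot : (⊥ : Ideal R).IsPrime := Ideal.isPrime_bot
  have hcofactor : D.cofactor ∉ monomialIdeal ⊥ a :=
    D.cofactor_notMem hbot ha fun j _ hj => D.eval_one_ne_zero j hj
  have hξ : D.ξ ∉ (⊥ : Ideal R) := fun hξ => ht.schurElement_ne_zero hD <| by
    rw [D.value_eq, Ideal.mem_bot.1 hξ, map_zero, zero_mul, map_zero]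
  refine ⟨D.value, ?_, hD⟩
  rw [D.value_eq, (monomialIdeal_isPrime _ hbot a ha).mul_mem_iff_mem_or_mem, not_or]
  exact ⟨algebraMap_notMem_monomialIdeal ha hξ, hcofactor⟩

variable [IsIntegrallyClosed R]

theorem IsBlockAt.monomialIdeal (ht : IsSymmetrizing t)
    (hH : IsSplitSemisimple (FractionRing (Laurent R n)) (GenericFiber (Laurent R n) H))
    (hess : IsEssential t) (hp : p.IsPrime) (ha : IsPrimitiveExponent a)
    {C : Set (IrrGeneric (Laurent R n) H)}
    (hC : IsBlockAt (extendedIdeal p n) (extendedIdeal_isPrime p hp n) C)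
    (hCM : ∀ χ ∈ C, ¬ IsEssentialMonomial t p a χ) :
    IsBlockAt (EssentialAlgebra.monomialIdeal p a) (monomialIdeal_isPrime p hp a ha) C := by
  obtain ⟨k, d, hd, ⟨Φ⟩⟩ := hH.exists_algEquiv_matrixProd
  rw [isBlockAt_iff_minimal Φ] at hC ⊢
  exact hC.mono (fun T => And.imp_right IsBlockUnionAt.extendedIdeal_of_monomialIdeal)
    ⟨hC.prop.1, hC.prop.2.monomialIdeal_of_extendedIdeal ht hess hp ha fun i hi => hCM _ hi⟩

theorem isBlockAt_extendedIdeal_iff_monomialIdeal (ht : IsSymmetrizing t)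
    (hH : IsSplitSemisimple (FractionRing (Laurent R n)) (GenericFiber (Laurent R n) H))
    (hess : IsEssential t) (hp : p.IsPrime) (ha : IsPrimitiveExponent a)
    (hM : ∀ χ, ¬ IsEssentialMonomial t p a χ) (C : Set (IrrGeneric (Laurent R n) H)) :
    IsBlockAt (extendedIdeal p n) (extendedIdeal_isPrime p hp n) C ↔
      IsBlockAt (monomialIdeal p a) (monomialIdeal_isPrime p hp a ha) C := by
  obtain ⟨k, d, hd, ⟨Φ⟩⟩ := hH.exists_algEquiv_matrixProd
  have hunion : IsBlockUnionAt (rep Φ) (extendedIdeal p n) =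
      IsBlockUnionAt (rep Φ) (monomialIdeal p a) := by
    ext S
    exact ⟨IsBlockUnionAt.monomialIdeal_of_extendedIdeal ht hess hp ha fun i _ => hM _,
      IsBlockUnionAt.extendedIdeal_of_monomialIdeal⟩
  rw [isBlockAt_iff_minimal Φ, isBlockAt_iff_minimal Φ, hunion]

end EssentialBlocks

section SpecializedBlocks

variable {A B : Type u} [CommRing A] [IsDomain A] [IsIntegrallyClosed A] [CommRing B] [IsDomain B]
  {φ : A →+* B} {H : Type v} [Ring H] [Algebra A H] [Module.Finite A H]
  {ι : Type*} [Finite ι] {d : ι → ℕ} [∀ i, NeZero (d i)]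
  {Φ : GenericFiber A H ≃ₐ[FractionRing A] MatrixProd d (FractionRing A)}
  {Φ' : GenericFiber B (Specialization φ H) ≃ₐ[FractionRing B] MatrixProd d (FractionRing B)}

theorem IsCompatible.isSpecializedCharacter_irrEquiv (hΦ : IsCompatible φ Φ Φ') (i : ι) :
    IsSpecializedCharacter φ (irrEquiv.{u, v} Φ i) (irrEquiv.{u, max u v} Φ' i) := fun h => by
  obtain ⟨c, hc⟩ := exists_algebraMap_eq_trace Φ h i
  refine ⟨c, ?_, ?_⟩
  · rw [irrEquiv_apply, hc, rep_apply]
  · rw [irrEquiv_apply, hΦ.trace h c i hc, rep_apply]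

theorem IsCompatible.isBlockAt_iff_image [Module.Free A H] (hΦ : IsCompatible φ Φ Φ')
    (hφ : Function.Surjective φ) {q : Ideal A} (hq : q.IsPrime) {q' : Ideal B} (hq' : q'.IsPrime)
    (hqq' : q'.comap φ = q) (C : Set (IrrGeneric A H)) :
    IsBlockAt q hq C ↔
      IsBlockAt q' hq' ((irrEquiv.{u, v} Φ).symm.trans (irrEquiv.{u, max u v} Φ') '' C) := by
  have hunion : IsBlockUnionAt (rep Φ) q = IsBlockUnionAt (rep Φ') q' := by
    ext S
    exact ⟨fun h => h.specialize hΦ hqq'.le, fun h => h.of_specialize hΦ hφ hqq'⟩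
  rw [isBlockAt_iff_minimal Φ, isBlockAt_iff_minimal Φ', hunion, Equiv.coe_trans, Set.image_comp,
    Set.preimage_image_eq _ (Equiv.injective _), Equiv.image_symm_eq_preimage]

end SpecializedBlocks

theorem exists_equiv_isSpecializedCharacter {R : Type u} [CommRing R] [IsDomain R]
    [IsIntegrallyClosed R] {m : ℕ} {H : Type v} [Ring H]
    [Algebra (Laurent R (m + 1)) H] [Module.Free (Laurent R (m + 1)) H]
    [Module.Finite (Laurent R (m + 1)) H] {t : H →ₗ[Laurent R (m + 1)] Laurent R (m + 1)}
    (ht : IsSymmetrizing t)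
    (hH : IsSplitSemisimple (FractionRing (Laurent R (m + 1)))
      (GenericFiber (Laurent R (m + 1)) H))
    (hess : IsEssential t) {p : Ideal R} (hp : p.IsPrime) {a : Fin (m + 1) → ℤ}
    (ha : IsPrimitiveExponent a) {φ : Laurent R (m + 1) →ₐ[R] Laurent R m}
    (hφ : IsAssociatedMorphism a φ) :
    ∃ τ : IrrGeneric (Laurent R (m + 1)) H ≃
        IrrGeneric (Laurent R m) (Specialization φ.toRingHom H),
      (∀ χ, IsSpecializedCharacter φ.toRingHom χ (τ χ)) ∧
      ∀ C : Set (IrrGeneric (Laurent R (m + 1)) H),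
        IsBlockAt (monomialIdeal p a) (monomialIdeal_isPrime p hp a ha) C ↔
        IsBlockAt (extendedIdeal p m) (extendedIdeal_isPrime p hp m) (τ '' C) := by
  obtain ⟨k, d, hd, ⟨Φ₀⟩⟩ := hH.exists_algEquiv_matrixProd
  have _ := isIntegrallyClosed_laurent R (m + 1)
  have _ := monomialIdeal_isPrime ⊥ (Ideal.isPrime_bot (α := R)) a ha
  have _ := isPrincipalIdealRing_localization_monomialIdeal (R := R) ha
  obtain ⟨Φ, Φ', hΦ⟩ := ht.exists_isCompatible φ.toRingHom Φ₀ (monomialIdeal ⊥ a)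
    hφ.eq_zero_iff (hess.exists_isSchurElement_notMem ht hH ha)
  refine ⟨(irrEquiv.{u, v} Φ).symm.trans (irrEquiv.{u, max u v} Φ'), fun χ => ?_, ?_⟩
  · obtain ⟨i, rfl⟩ := (irrEquiv.{u, v} Φ).surjective χ
    rw [Equiv.trans_apply, Equiv.symm_apply_apply]
    exact hΦ.isSpecializedCharacter_irrEquiv i
  · have hcomap : (extendedIdeal p m).comap φ.toRingHom = monomialIdeal p a :=
      Ideal.ext (hφ.mem_extendedIdeal_iff p)
    exact hΦ.isBlockAt_iff_image hφ.surjective _ _ hcomap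

end EssentialAlgebra

end

theorem mainTheorem6_general
    {R : Type*} [CommRing R] [IsDomain R] [IsIntegrallyClosed R]
    {m : ℕ} {H : Type*} [Ring H] [Algebra (Laurent R (m + 1)) H]
    [Module.Free (Laurent R (m + 1)) H] [Module.Finite (Laurent R (m + 1)) H]
    (t : H →ₗ[Laurent R (m + 1)] Laurent R (m + 1)) (ht : IsSymmetrizing t)
    (hH : IsSplitSemisimple (FractionRing (Laurent R (m + 1)))
      (GenericFiber (Laurent R (m + 1)) H))
    (hess : IsEssential t)
    (p : Ideal R) (hp : p.IsPrime)
    (a : Fin (m + 1) → ℤ) (ha : IsPrimitiveExponent a) :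
    (∀ C : Set (IrrGeneric (Laurent R (m + 1)) H),
      IsBlockAt (extendedIdeal p (m + 1)) (extendedIdeal_isPrime p hp (m + 1)) C →
      (∀ χ ∈ C, ¬ IsEssentialMonomial t p a χ) →
      IsBlockAt (monomialIdeal p a) (monomialIdeal_isPrime p hp a ha) C) ∧
    ((∀ χ, ¬ IsEssentialMonomial t p a χ) →
      ∀ C : Set (IrrGeneric (Laurent R (m + 1)) H),
        IsBlockAt (extendedIdeal p (m + 1)) (extendedIdeal_isPrime p hp (m + 1)) C ↔
        IsBlockAt (monomialIdeal p a) (monomialIdeal_isPrime p hp a ha) C) ∧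
    ∀ φ : Laurent R (m + 1) →ₐ[R] Laurent R m, IsAssociatedMorphism a φ →
      ∃ τ : IrrGeneric (Laurent R (m + 1)) H ≃
          IrrGeneric (Laurent R m) (Specialization φ.toRingHom H),
        (∀ χ, IsSpecializedCharacter φ.toRingHom χ (τ χ)) ∧
        (∀ C : Set (IrrGeneric (Laurent R (m + 1)) H),
          IsBlockAt (extendedIdeal p (m + 1)) (extendedIdeal_isPrime p hp (m + 1)) C →
          (∀ χ ∈ C, ¬ IsEssentialMonomial t p a χ) →
          IsBlockAt (extendedIdeal p m) (extendedIdeal_isPrime p hp m) (τ '' C)) ∧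
        ((∀ χ, ¬ IsEssentialMonomial t p a χ) →
          ∀ C : Set (IrrGeneric (Laurent R (m + 1)) H),
            IsBlockAt (extendedIdeal p (m + 1)) (extendedIdeal_isPrime p hp (m + 1)) C ↔
            IsBlockAt (extendedIdeal p m) (extendedIdeal_isPrime p hp m) (τ '' C)) := by
  refine ⟨fun C hC hCM => hC.monomialIdeal ht hH hess hp ha hCM,
    isBlockAt_extendedIdeal_iff_monomialIdeal ht hH hess hp ha, fun φ hφ => ?_⟩
  obtain ⟨τ, hτ, hblock⟩ := exists_equiv_isSpecializedCharacter ht hH hess hp ha hφ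
  exact ⟨τ, hτ, fun C hC hCM => (hblock C).1 (hC.monomialIdeal ht hH hess hp ha hCM),
    fun hM C => (isBlockAt_extendedIdeal_iff_monomialIdeal ht hH hess hp ha hM C).trans (hblock C)⟩

theorem mainTheorem6
    {R : Type*} [CommRing R] [IsDomain R] [IsNoetherianRing R] [IsIntegrallyClosed R]
    {m : ℕ} {H : Type*} [Ring H] [Algebra (Laurent R (m + 1)) H]
    [Module.Free (Laurent R (m + 1)) H] [Module.Finite (Laurent R (m + 1)) H]
    (t : H →ₗ[Laurent R (m + 1)] Laurent R (m + 1)) (ht : IsSymmetrizing t)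
    (hH : IsSplitSemisimple (FractionRing (Laurent R (m + 1)))
      (GenericFiber (Laurent R (m + 1)) H))
    (hess : IsEssential t)
    (p : Ideal R) (hp : p.IsPrime)
    (a : Fin (m + 1) → ℤ) (ha : IsPrimitiveExponent a) :
    (∀ C : Set (IrrGeneric (Laurent R (m + 1)) H),
      IsBlockAt (extendedIdeal p (m + 1)) (extendedIdeal_isPrime p hp (m + 1)) C →
      (∀ χ ∈ C, ¬ IsEssentialMonomial t p a χ) →
      IsBlockAt (monomialIdeal p a) (monomialIdeal_isPrime p hp a ha) C) ∧
    ((∀ χ, ¬ IsEssentialMonomial t p a χ) →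
      ∀ C : Set (IrrGeneric (Laurent R (m + 1)) H),
        IsBlockAt (extendedIdeal p (m + 1)) (extendedIdeal_isPrime p hp (m + 1)) C ↔
        IsBlockAt (monomialIdeal p a) (monomialIdeal_isPrime p hp a ha) C) ∧
    ∀ φ : Laurent R (m + 1) →ₐ[R] Laurent R m, IsAssociatedMorphism a φ →
      ∃ τ : IrrGeneric (Laurent R (m + 1)) H ≃
          IrrGeneric (Laurent R m) (Specialization φ.toRingHom H),
        (∀ χ, IsSpecializedCharacter φ.toRingHom χ (τ χ)) ∧
        (∀ C : Set (IrrGeneric (Laurent R (m + 1)) H),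
          IsBlockAt (extendedIdeal p (m + 1)) (extendedIdeal_isPrime p hp (m + 1)) C →
          (∀ χ ∈ C, ¬ IsEssentialMonomial t p a χ) →
          IsBlockAt (extendedIdeal p m) (extendedIdeal_isPrime p hp m) (τ '' C)) ∧
        ((∀ χ, ¬ IsEssentialMonomial t p a χ) →
          ∀ C : Set (IrrGeneric (Laurent R (m + 1)) H),
            IsBlockAt (extendedIdeal p (m + 1)) (extendedIdeal_isPrime p hp (m + 1)) C ↔
            IsBlockAt (extendedIdeal p m) (extendedIdeal_isPrime p hp m) (τ '' C)) :=
  mainTheorem6_general t ht hH hess p hp a ha
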